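/- Let $\mathcal{E}$ be an idempotent complete exact category in the sense of Quillen, with Yoneda extension groups $\operatorname{Ext}^i_{\mathcal{E}}$, and let $m,n\ge 0$ be integers. For an exact category $\mathcal{F}$ and an object $X$, $\operatorname{pdim}_{\mathcal F} X\in\mathbb{N}_0\cup\{\infty\}$ is the least $k$ with $\operatorname{Ext}^{k+1}_{\mathcal{F}}(X,-)=0$ (and $\infty$ if there is none), and $\operatorname{gldim}\mathcal{F}=\sup_{X}\operatorname{pdim}_{\mathcal{F}}X$. A full subcategory of $\mathcal F$ closed under extensions is regarded as a fully exact subcategory, i.e. with the short exact sequences of $\mathcal F$ all of whose terms lie in it. A full subcategory $\mathcal{X}\subseteq\mathcal{F}$ is *resolving* if it is closed under extensions and under kernels of deflations between its objects, and every object $M$ of $\mathcal F$ admits a deflation $X\to M$ with $X\in\mathcal{X}$; it is *$m$-resolving* if moreover every object $M$ of $\mathcal{F}$ has an exact sequence $0\to X_m\to\cdots\to X_0\to M\to 0$ with all $X_i\in\mathcal{X}$. Dually, $\mathcal X$ is *coresolving* if it is closed under extensions and under cokernels of inflations between its objects, and every object $M$ of $\mathcal F$ admits an inflation $M\to X$ with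 $X\in\mathcal X$. For a full subcategory $\mathcal{T}$ of $\mathcal{E}$ let $\mathcal{T}^{\perp}$ be the full subcategory of all $M$ with $\operatorname{Ext}^i_{\mathcal{E}}(T,M)=0$ for all $i\ge1$ and $T\in\mathcal{T}$. The subcategory $\mathcal{T}$ is *$n$-tilting* if (T1) $\mathcal{T}\subseteq\mathcal{T}^{\perp}$ and the fully exact subcategory $\mathcal{T}^{\perp}$ has enough projectives, its projective objects being exactly the objects of $\mathcal{T}$; and (T2) $\mathcal{T}^{\perp}$ is coresolving in $\mathcal{E}$ and every object $M$ of $\mathcal{E}$ has an exact sequence $0\to M\to X_0\to\cdots\to X_n\to0$ with all $X_i\in\mathcal{T}^{\perp}$. Let $\operatorname{mod}_\infty\text{-}\mathcal{T}$ be the category of additive functors $F\colon\mathcal{T}^{op}\to Ab$ that admit an exact sequence $\cdots\to\operatorname{Hom}_{\mathcal{T}}(-,T_1)\to\operatorname{Hom}_{\mathcal{T}}(-,T_0)\to F\to0$ with all $T_i\in\mathcal{T}$, with the objectwise short exact sequences. An $n$-tilting subcategory $\mathcal{T}$ is *$m$-ideq $n$-tilting* if the essential image of $f_{\mathcal{T}}\colon\mathcal{T}^{\perp}\to\operatorname{mod}_\infty\text{-}\mathcal{T}$,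 $X\mapsto\operatorname{Hom}_{\mathcal{E}}(-,X)|_{\mathcal{T}}$, is an $m$-resolving subcategory of $\operatorname{mod}_\infty\text{-}\mathcal{T}$. **Proposition.** If $\mathcal{T}$ is an $m$-ideq $n$-tilting subcategory of $\mathcal{E}$, then $$\operatorname{gldim}\mathcal{E}\le\operatorname{gldim}(\operatorname{mod}_\infty\text{-}\mathcal{T})+n\quad\text{and}\quad\operatorname{gldim}(\operatorname{mod}_\infty\text{-}\mathcal{T})\le\operatorname{gldim}\mathcal{E}+m$$ (in $\mathbb{N}_0\cup\{\infty\}$). -/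

import Mathlib

open CategoryTheory CategoryTheory.Limits

universe v u

namespace ExactCat

/-! ### Exact categories in the sense of Quillen -/

section Basic

variable {C : Type u} [Category.{v} C] [HasZeroMorphisms C]

/-- For a class `σ` of short complexes, `i` is an inflation if it is the first map of a member
of `σ`. -/
def IsInflation (σ : ObjectProperty (ShortComplex C)) {X Y : C} (i : X ⟶ Y) : Prop :=
  ∃ (Z : C) (p : Y ⟶ Z) (w : i ≫ p = 0), σ (ShortComplex.mk i p w)

/-- For a class `σ` of short complexes, `p` is a deflation if it is the second map of a member
of `σ`. -/
def IsDeflation (σ : ObjectProperty (ShortComplex C)) {Y Z : C} (p : Y ⟶ Z) : Prop :=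
  ∃ (X : C) (i : X ⟶ Y) (w : i ≫ p = 0), σ (ShortComplex.mk i p w)

end Basic

/-- An exact structure (Quillen, in Bühler's formulation): a class of kernel-cokernel pairs,
the *short exact sequences* or *conflations*, closed under isomorphisms, such that identities are
inflations and deflations, inflations and deflations are closed under composition, and pushouts of
inflations (pullbacks of deflations) along arbitrary morphisms exist and are again inflations
(deflations). -/
structure ExactStructure (C : Type u) [Category.{v} C] [Preadditive C] where
  /-- The class of short exact sequences. -/
  conflation : ObjectProperty (ShortComplex C)
  of_iso : ∀ {S S' : ShortComplex C}, (S ≅ S') → conflation S → conflation S'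
  isKernel : ∀ {S : ShortComplex C}, conflation S →
    Nonempty (IsLimit (KernelFork.ofι S.f S.zero))
  isCokernel : ∀ {S : ShortComplex C}, conflation S →
    Nonempty (IsColimit (CokernelCofork.ofπ S.g S.zero))
  id_inflation : ∀ X : C, IsInflation conflation (𝟙 X)
  id_deflation : ∀ X : C, IsDeflation conflation (𝟙 X)
  comp_inflation : ∀ {X Y Z : C} (i : X ⟶ Y) (j : Y ⟶ Z),
    IsInflation conflation i → IsInflation conflation j → IsInflation conflation (i ≫ j)
  comp_deflation : ∀ {X Y Z : C} (p : X ⟶ Y) (q : Y ⟶ Z),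
    IsDeflation conflation p → IsDeflation conflation q → IsDeflation conflation (p ≫ q)
  pushout_inflation : ∀ {A B A' : C} (i : A ⟶ B) (f : A ⟶ A'), IsInflation conflation i →
    ∃ (B' : C) (g : B ⟶ B') (i' : A' ⟶ B'), IsPushout i f g i' ∧ IsInflation conflation i'
  pullback_deflation : ∀ {B D D' : C} (p : B ⟶ D) (f : D' ⟶ D), IsDeflation conflation p →
    ∃ (B' : C) (g : B' ⟶ B) (p' : B' ⟶ D'), IsPullback g p' p f ∧ IsDeflation conflation p'

/-! ### Yoneda extensions, projective dimension and global dimension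

The notions of this section depend only on a category together with its class `σ` of short exact
sequences; they are used for exact categories and their fully exact subcategories. -/

section Ext

variable {C : Type u} [Category.{v} C] [HasZeroMorphisms C]

/-- A short exact sequence `0 ⟶ Y ⟶ mid ⟶ X ⟶ 0`. -/
structure ShortExt (σ : ObjectProperty (ShortComplex C)) (X Y : C) where
  mid : C
  i : Y ⟶ mid
  p : mid ⟶ X
  w : i ≫ p = 0
  mem : σ (ShortComplex.mk i p w)

/-- `NExt σ k X Y` consists of the exact sequences
`0 ⟶ Y ⟶ E_k ⟶ ⋯ ⟶ E_0 ⟶ X ⟶ 0` with `k + 1` middle terms, given as splices of `k + 1` short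
exact sequences: for `k = 0` this is a short exact sequence, and for `k + 1` it is a short exact
sequence `0 ⟶ Z ⟶ E_0 ⟶ X ⟶ 0` spliced with an exact sequence from `Y` to `Z`. -/
def NExt (σ : ObjectProperty (ShortComplex C)) : ℕ → C → C → Type (max u v)
  | 0, X, Y => ShortExt σ X Y
  | k + 1, X, Y => Σ Z : C, ShortExt σ X Z × NExt σ k Z Y

/-- `NExt.Map σ k f ξ η`: there is a morphism of exact sequences from `ξ` to `η` which is `f` on
the right-hand end terms and the identity of `Y` on the left-hand end terms. -/
def NExt.Map (σ : ObjectProperty (ShortComplex C)) :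
    ∀ (k : ℕ) {X X' Y : C}, (X ⟶ X') → NExt σ k X Y → NExt σ k X' Y → Prop
  | 0, _, _, _, f, (ξ : ShortExt σ _ _), (η : ShortExt σ _ _) =>
      ∃ a : ξ.mid ⟶ η.mid, ξ.i ≫ a = η.i ∧ a ≫ η.p = ξ.p ≫ f
  | k + 1, _, _, _, f, ⟨Z, ξ, ξ'⟩, ⟨Z', η, η'⟩ =>
      ∃ (z : Z ⟶ Z') (a : ξ.mid ⟶ η.mid),
        ξ.i ≫ a = z ≫ η.i ∧ a ≫ η.p = ξ.p ≫ f ∧ NExt.Map σ k z ξ' η'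

/-- The Yoneda extension groups `Ext^n(X, Y)` (their underlying sets): `Ext^0` is `Hom`, and for
`n ≥ 1` one takes exact sequences `0 ⟶ Y ⟶ E_{n-1} ⟶ ⋯ ⟶ E_0 ⟶ X ⟶ 0` modulo the equivalence
relation generated by morphisms of exact sequences which are the identity on `X` and `Y`. -/
def Ext (σ : ObjectProperty (ShortComplex C)) : ℕ → C → C → Type (max u v)
  | 0, X, Y => ULift.{u} (X ⟶ Y)
  | k + 1, X, Y => Quot (fun ξ η : NExt σ k X Y => NExt.Map σ k (𝟙 X) ξ η)

/-- `Ext^n(X, Y) = 0`. -/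
def ExtVanish (σ : ObjectProperty (ShortComplex C)) (n : ℕ) (X Y : C) : Prop :=
  Subsingleton (Ext σ n X Y)

/-- `pdim X ≤ n` means `Ext^{n+1}(X, -) = 0`; the projective dimension of `X` is the least such
`n`, and `∞` if there is none. -/
noncomputable def pdim (σ : ObjectProperty (ShortComplex C)) (X : C) : ℕ∞ :=
  ⨅ (n : ℕ) (_ : ∀ Y : C, ExtVanish σ (n + 1) X Y), (n : ℕ∞)

/-- The global dimension: the supremum of the projective dimensions of all objects. -/
noncomputable def gldim (σ : ObjectProperty (ShortComplex C)) : ℕ∞ :=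
  ⨆ X : C, pdim σ X

/-! ### Subcategories -/

/-- Projective objects: every morphism to the end term of a short exact sequence lifts. -/
def IsProj (σ : ObjectProperty (ShortComplex C)) (P : C) : Prop :=
  ∀ S : ShortComplex C, σ S → ∀ f : P ⟶ S.X₃, ∃ g : P ⟶ S.X₂, g ≫ S.g = f

/-- Enough projectives: every object is the end term of a short exact sequence with projective
middle term. -/
def EnoughProj (σ : ObjectProperty (ShortComplex C)) : Prop :=
  ∀ X : C, ∃ (P K : C) (i : K ⟶ P) (p : P ⟶ X) (w : i ≫ p = 0),
    IsProj σ P ∧ σ (ShortComplex.mk i p w)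

def ExtensionClosed (σ : ObjectProperty (ShortComplex C)) (P : ObjectProperty C) : Prop :=
  ∀ S : ShortComplex C, σ S → P S.X₁ → P S.X₃ → P S.X₂

/-- Closed under cokernels of inflations between objects of the subcategory. -/
def InflationClosed (σ : ObjectProperty (ShortComplex C)) (P : ObjectProperty C) : Prop :=
  ∀ S : ShortComplex C, σ S → P S.X₁ → P S.X₂ → P S.X₃

/-- Closed under kernels of deflations between objects of the subcategory. -/
def DeflationClosed (σ : ObjectProperty (ShortComplex C)) (P : ObjectProperty C) : Prop :=
  ∀ S : ShortComplex C, σ S → P S.X₂ → P S.X₃ → P S.X₁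

/-- `pres(P)`: the objects `M` with a short exact sequence `0 ⟶ Z ⟶ X ⟶ M ⟶ 0`, `X` in `P`. -/
def pres (σ : ObjectProperty (ShortComplex C)) (P : ObjectProperty C) : ObjectProperty C :=
  fun M => ∃ (X : C) (p : X ⟶ M), P X ∧ IsDeflation σ p

/-- `copres(P)`: the objects `M` with a short exact sequence `0 ⟶ M ⟶ X ⟶ Z ⟶ 0`, `X` in `P`. -/
def copres (σ : ObjectProperty (ShortComplex C)) (P : ObjectProperty C) : ObjectProperty C :=
  fun M => ∃ (X : C) (i : M ⟶ X), P X ∧ IsInflation σ i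

/-- `Res_n(P)`: the objects `M` with an exact sequence `0 ⟶ X_n ⟶ ⋯ ⟶ X_0 ⟶ M ⟶ 0` (a splice of
short exact sequences) with all `X_i` in `P`. -/
def Res (σ : ObjectProperty (ShortComplex C)) (P : ObjectProperty C) : ℕ → ObjectProperty C
  | 0 => P.isoClosure
  | n + 1 => fun M => ∃ (K X : C) (i : K ⟶ X) (p : X ⟶ M) (w : i ≫ p = 0),
      σ (ShortComplex.mk i p w) ∧ P X ∧ Res σ P n K

/-- `Cores_n(P)`: the objects `M` with an exact sequence `0 ⟶ M ⟶ X_0 ⟶ ⋯ ⟶ X_n ⟶ 0` (a splice of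
short exact sequences) with all `X_i` in `P`. -/
def Cores (σ : ObjectProperty (ShortComplex C)) (P : ObjectProperty C) : ℕ → ObjectProperty C
  | 0 => P.isoClosure
  | n + 1 => fun M => ∃ (X Q : C) (i : M ⟶ X) (p : X ⟶ Q) (w : i ≫ p = 0),
      σ (ShortComplex.mk i p w) ∧ P X ∧ Cores σ P n Q

structure IsResolving (σ : ObjectProperty (ShortComplex C)) (P : ObjectProperty C) : Prop where
  extensionClosed : ExtensionClosed σ P
  deflationClosed : DeflationClosed σ P
  pres_all : ∀ M : C, pres σ P M

structure IsCoresolving (σ : ObjectProperty (ShortComplex C)) (P : ObjectProperty C) : Prop where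
  extensionClosed : ExtensionClosed σ P
  inflationClosed : InflationClosed σ P
  copres_all : ∀ M : C, copres σ P M

/-- `m`-resolving subcategories. -/
structure IsNResolving (σ : ObjectProperty (ShortComplex C)) (P : ObjectProperty C) (m : ℕ) :
    Prop where
  resolving : IsResolving σ P
  res_all : ∀ M : C, Res σ P m M

/-- Finitely coresolving subcategories. -/
structure IsFinitelyCoresolving (σ : ObjectProperty (ShortComplex C)) (P : ObjectProperty C) :
    Prop where
  coresolving : IsCoresolving σ P
  cores_all : ∀ M : C, ∃ n : ℕ, Cores σ P n M

/-- The right perpendicular category: `M` with `Ext^i(T, M) = 0` for all `i ≥ 1` and all `T` in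
the given subcategory. -/
def perp (σ : ObjectProperty (ShortComplex C)) (T : ObjectProperty C) : ObjectProperty C :=
  fun M => ∀ i : ℕ, 1 ≤ i → ∀ X : C, T X → ExtVanish σ i X M

end Ext

section Additive

variable {C : Type u} [Category.{v} C] [Preadditive C]

/-- The class of short exact sequences of a fully exact subcategory: the short exact sequences of
the ambient category all of whose terms lie in the subcategory. -/
def restrict (σ : ObjectProperty (ShortComplex C)) (P : ObjectProperty C) :
    ObjectProperty (ShortComplex P.FullSubcategory) :=
  fun S => σ (S.map P.ι)

/-- Tilting subcategories. (T1): `T` is self-orthogonal, and the fully exact subcategory `T^⊥` has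
enough projectives, the projectives being precisely the objects of `T`.
(T2): `T^⊥` is finitely coresolving. -/
structure IsTilting (σ : ObjectProperty (ShortComplex C)) (T : ObjectProperty C) : Prop where
  selfOrthogonal : ∀ X : C, T X → perp σ T X
  enoughProj : EnoughProj (restrict σ (perp σ T))
  proj_iff : ∀ X : (perp σ T).FullSubcategory, IsProj (restrict σ (perp σ T)) X ↔ T X.obj
  finitelyCoresolving : IsFinitelyCoresolving σ (perp σ T)

/-- `n`-tilting subcategories. -/
structure IsNTilting (σ : ObjectProperty (ShortComplex C)) (T : ObjectProperty C) (n : ℕ) :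
    Prop where
  tilting : IsTilting σ T
  cores_all : ∀ M : C, Cores σ (perp σ T) n M

/-- The category `mod_∞-T` for a preadditive category `D`, as a full subcategory of the category
of functors `Dᵒᵖ ⥤ Ab`: the additive functors `F` with an exact sequence
`⋯ ⟶ Hom(-, X_2) ⟶ Hom(-, X_1) ⟶ Hom(-, X_0) ⟶ F ⟶ 0`. -/
def modInfty (D : Type u) [Category.{v} D] [Preadditive D] :
    ObjectProperty (Dᵒᵖ ⥤ AddCommGrpCat.{v}) :=
  fun F => F.Additive ∧
    ∃ (X : ℕ → D)
      (d : ∀ i : ℕ, preadditiveYoneda.obj (X (i + 1)) ⟶ preadditiveYoneda.obj (X i))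
      (π : preadditiveYoneda.obj (X 0) ⟶ F),
      Epi π ∧ (∃ w : d 0 ≫ π = 0, (ShortComplex.mk (d 0) π w).Exact) ∧
        ∀ i : ℕ, ∃ w : d (i + 1) ≫ d i = 0, (ShortComplex.mk (d (i + 1)) (d i) w).Exact

/-- The short exact sequences of `mod_∞-D`, as a fully exact subcategory of the abelian category of
`D`-modules (exactness is tested objectwise). -/
def modConflation (D : Type u) [Category.{v} D] [Preadditive D] :
    ObjectProperty (ShortComplex (modInfty D).FullSubcategory) :=
  restrict (fun S => S.ShortExact) (modInfty D)

/-- The tilting functor `f_T`, sending `X` in `T^⊥` to the restriction of `Hom(-, X)` to `T`. (For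
tilting `T` it takes values in `mod_∞-T`.) -/
def tiltingFunctor (σ : ObjectProperty (ShortComplex C)) (T : ObjectProperty C) :
    (perp σ T).FullSubcategory ⥤ (T.FullSubcategoryᵒᵖ ⥤ AddCommGrpCat.{v}) :=
  (perp σ T).ι ⋙ preadditiveYoneda ⋙ (Functor.whiskeringLeft _ _ _).obj T.ι.op

/-- The essential image of `f_T`, as a full subcategory of `mod_∞-T`. -/
def tiltingImage (σ : ObjectProperty (ShortComplex C)) (T : ObjectProperty C) :
    ObjectProperty (modInfty T.FullSubcategory).FullSubcategory :=
  fun F => (tiltingFunctor σ T).essImage F.obj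

/-- `m`-ideq `n`-tilting subcategories: `n`-tilting subcategories such that the essential image of
the tilting functor is `m`-resolving in `mod_∞-T`. -/
structure IsIdeqTilting (σ : ObjectProperty (ShortComplex C)) (T : ObjectProperty C) (m n : ℕ) :
    Prop where
  nTilting : IsNTilting σ T n
  image_resolving : IsNResolving (modConflation T.FullSubcategory) (tiltingImage σ T) m

end Additive

end ExactCat

/-!
The two inequalities are obtained by comparing both categories with `T^⊥`, by means of resolutions
by objects of `T`.

*Long exact sequences without groups.* For an arbitrary exact category, the vanishing of a Yoneda
class `f^* ξ` is described recursively by the predicate `Null`: writing `ξ` as the splice of `α`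
and `β`, the class `f^* ξ` vanishes if and only if `f^* α = z_* α'` for some conflation `α'` and
some morphism `z` for which `z^* β` vanishes. This predicate is invariant under morphisms of exact
sequences that are the identity on the left-hand ends (`Null.map`, `Null.of_map`), whence
`extVanish_succ_iff`. The exactness of the long Ext-sequences follows by induction on the degree
(`exists_equiv_pull_of_null`, `exists_equiv_splice_of_null`, `exists_equiv_spliceLeft`), and with
it the three forms of dimension shifting that are needed: `extVanish_left`, `extVanish_right` and
`extVanish_second`.

*The category `mod_∞-T`.* It is closed under extensions in the abelian category of all functors,
by a coinductive form of the horseshoe lemma; hence it is an exact category (`fullyExact`), in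
which the representable functors are projective. The tilting functor is exact on `T^⊥`, and it
takes the objects of `T` to representable functors.

*The comparison.* Objects of `T` are projective in `T^⊥` and have no higher extensions, in the
whole exact category, with values in `T^⊥`. Thus, if the base category has global dimension at
most `d`, dimension shifting along a resolution of an object of `T^⊥` by objects of `T` shows that
its `d`-th syzygy belongs to `T`. The same conclusion holds if `mod_∞-T` has global dimension at
most `d`: a retraction onto the image of a syzygy lifts along the tilting functor, by the Yoneda
lemma. In both cases every object of `T^⊥` has a resolution of length `d` by objects of `T`. The
`m`-step resolutions of the objects of `mod_∞-T` by images of objects of `T^⊥` then bound the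
global dimension of `mod_∞-T` by `d + m`. In the base category, one first bounds extensions
between objects of `T^⊥`; `n`-step coresolutions extend the bound to an arbitrary first argument
at no cost, and to an arbitrary second argument at the cost of `n`.
-/

namespace ExactCat

/-! ### Elementary properties of exact categories -/

section Conflations

variable {C : Type u} [Category.{v} C] [Preadditive C] {E : ExactStructure C}

namespace ShortExt

variable {X Y : C} (α : ShortExt E.conflation X Y)

include α in
lemma mono_i : Mono α.i := by
  obtain ⟨h⟩ := E.isKernel α.mem
  exact ⟨fun a b hab => Fork.IsLimit.hom_ext h hab⟩

lemma epi_p : Epi α.p := by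
  obtain ⟨h⟩ := E.isCokernel α.mem
  exact ⟨fun a b hab => Cofork.IsColimit.hom_ext h hab⟩

lemma exists_lift {W : C} (g : W ⟶ α.mid) (hg : g ≫ α.p = 0) : ∃ l : W ⟶ Y, l ≫ α.i = g := by
  obtain ⟨h⟩ := E.isKernel α.mem
  obtain ⟨l, hl⟩ := KernelFork.IsLimit.lift' h g hg
  exact ⟨l, hl⟩

lemma exists_desc {W : C} (g : α.mid ⟶ W) (hg : α.i ≫ g = 0) : ∃ l : X ⟶ W, α.p ≫ l = g := by
  obtain ⟨h⟩ := E.isCokernel α.mem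
  obtain ⟨l, hl⟩ := CokernelCofork.IsColimit.desc' h g hg
  exact ⟨l, hl⟩

lemma isDeflation : IsDeflation E.conflation α.p := ⟨_, _, α.w, α.mem⟩

lemma isInflation : IsInflation E.conflation α.i := ⟨_, _, α.w, α.mem⟩

end ShortExt

/-- Any kernel of a deflation completes it to a conflation. -/
lemma conflation_of_isDeflation {A M X : C} (i : A ⟶ M) (p : M ⟶ X) (w : i ≫ p = 0)
    (hp : IsDeflation E.conflation p) (hi : Mono i)
    (hl : ∀ {W : C} (g : W ⟶ M), g ≫ p = 0 → ∃ l : W ⟶ A, l ≫ i = g) :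
    E.conflation (ShortComplex.mk i p w) := by
  obtain ⟨K, j, w', h⟩ := hp
  let α : ShortExt E.conflation X K := ⟨M, j, p, w', h⟩
  have := α.mono_i
  obtain ⟨a, ha⟩ := hl j w'
  obtain ⟨b, hb⟩ := α.exists_lift i w
  change b ≫ j = i at hb
  have hj : Mono j := α.mono_i
  refine E.of_iso (ShortComplex.isoMk (S₁ := ShortComplex.mk j p w') ⟨a, b, ?_, ?_⟩
    (Iso.refl M) (Iso.refl X) ?_ ?_) h
  · rw [← cancel_mono j]; simp [hb, ha]
  · rw [← cancel_mono i]; simp [hb, ha]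
  · simp [ha]
  · simp

/-- Any cokernel of an inflation completes it to a conflation. -/
lemma conflation_of_isInflation {A M X : C} (i : A ⟶ M) (p : M ⟶ X) (w : i ≫ p = 0)
    (hi : IsInflation E.conflation i) (hp : Epi p)
    (hl : ∀ {W : C} (g : M ⟶ W), i ≫ g = 0 → ∃ l : X ⟶ W, p ≫ l = g) :
    E.conflation (ShortComplex.mk i p w) := by
  obtain ⟨K, q, w', h⟩ := hi
  let α : ShortExt E.conflation K A := ⟨M, i, q, w', h⟩
  obtain ⟨a, ha⟩ := hl q w'
  obtain ⟨b, hb⟩ := α.exists_desc p w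
  change q ≫ b = p at hb
  have hq : Epi q := α.epi_p
  refine E.of_iso (ShortComplex.isoMk (S₁ := ShortComplex.mk i q w')
    (Iso.refl A) (Iso.refl M) ⟨b, a, ?_, ?_⟩ ?_ ?_) h
  · rw [← cancel_epi q]; simp [reassoc_of% hb, ha]
  · rw [← cancel_epi p]; simp [reassoc_of% ha, hb]
  · simp
  · simp [hb]

/-- Base change of a conflation along a morphism to its right-hand end term. -/
lemma exists_pullback {X Y W : C} (α : ShortExt E.conflation X Y) (f : W ⟶ X) :
    ∃ (β : ShortExt E.conflation W Y) (a : β.mid ⟶ α.mid),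
      IsPullback a β.p α.p f ∧ β.i ≫ a = α.i := by
  obtain ⟨B, g, p, h, hp⟩ := E.pullback_deflation α.p f α.isDeflation
  have := α.mono_i
  have hi : h.lift α.i 0 (by simp [α.w]) ≫ g = α.i := h.lift_fst _ _ _
  refine ⟨⟨B, h.lift α.i 0 (by simp [α.w]), p, h.lift_snd _ _ _,
    conflation_of_isDeflation _ _ _ hp ?_ ?_⟩, g, h, hi⟩
  · exact mono_of_mono_fac hi
  · intro W k hk
    obtain ⟨l, hl⟩ := α.exists_lift (k ≫ g) (by rw [Category.assoc, h.w, reassoc_of% hk, zero_comp])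
    exact ⟨l, h.hom_ext (by simp [hl]) (by simp [hk])⟩

/-- Cobase change of a conflation along a morphism from its left-hand end term. -/
lemma exists_pushout {X Y W : C} (α : ShortExt E.conflation X Y) (f : Y ⟶ W) :
    ∃ (β : ShortExt E.conflation X W) (a : α.mid ⟶ β.mid),
      IsPushout α.i f a β.i ∧ a ≫ β.p = α.p := by
  obtain ⟨B, g, i, h, hi⟩ := E.pushout_inflation α.i f α.isInflation
  have := α.epi_p
  have hp : g ≫ h.desc α.p 0 (by simp [α.w]) = α.p := h.inl_desc _ _ _
  refine ⟨⟨B, i, h.desc α.p 0 (by simp [α.w]), h.inr_desc _ _ _,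
    conflation_of_isInflation _ _ _ hi ?_ ?_⟩, g, h, hp⟩
  · exact epi_of_epi_fac hp
  · intro W k hk
    obtain ⟨l, hl⟩ := α.exists_desc (g ≫ k)
      (by rw [← Category.assoc, h.w, Category.assoc, hk, comp_zero])
    exact ⟨l, h.hom_ext (by simp [← hl, reassoc_of% hp]) (by simp [hk])⟩

/-- For a conflation `A ⟶ B ⟶ Q` and a deflation onto `B` with middle term `M` and kernel `Z`, the
kernel of the composite deflation `M ⟶ Q` is the middle term of the base change to `A`. -/
lemma exists_kernel_comp {B Z A Q : C} (α : ShortExt E.conflation B Z) (i : A ⟶ B) (q : B ⟶ Q)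
    (w : i ≫ q = 0) (hε : E.conflation (ShortComplex.mk i q w)) :
    ∃ (β : ShortExt E.conflation A Z) (a : β.mid ⟶ α.mid) (w' : a ≫ α.p ≫ q = 0),
      β.i ≫ a = α.i ∧ a ≫ α.p = β.p ≫ i ∧ IsPullback a β.p α.p i ∧
      E.conflation (ShortComplex.mk a (α.p ≫ q) w') := by
  let ε : ShortExt E.conflation Q A := ⟨B, i, q, w, hε⟩
  obtain ⟨β, a, h, ha⟩ := exists_pullback α i
  have hi : Mono i := ε.mono_i
  refine ⟨β, a, by rw [reassoc_of% h.w, w, comp_zero], ha, h.w, h,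
    conflation_of_isDeflation _ _ _ (E.comp_deflation _ _ α.isDeflation ε.isDeflation) ?_ ?_⟩
  · refine ⟨fun u v huv => h.hom_ext huv ?_⟩
    rw [← cancel_mono i, Category.assoc, Category.assoc, ← h.w, reassoc_of% huv]
  · intro W g hg
    obtain ⟨l, hl⟩ := ε.exists_lift (g ≫ α.p) (by simpa using hg)
    exact ⟨h.lift g l hl.symm, h.lift_fst _ _ _⟩

lemma exists_isZero (E : ExactStructure C) (X : C) : ∃ O : C, IsZero O := by
  obtain ⟨O, p, w, h⟩ := E.id_inflation X
  have hp : Epi p := (ShortExt.mk (σ := E.conflation) X (𝟙 X) p w h).epi_p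
  rw [Category.id_comp] at w
  subst w
  exact ⟨O, (IsZero.iff_id_eq_zero O).2 (by rw [← cancel_epi (0 : X ⟶ O)]; simp)⟩

/-- The conflation `X = X ⟶ O` for a zero object `O`. -/
lemma conflation_id_left (X : C) {O : C} (hO : IsZero O) :
    E.conflation (ShortComplex.mk (𝟙 X) (0 : X ⟶ O) comp_zero) :=
  conflation_of_isInflation _ _ _ (E.id_inflation X) ⟨fun a b _ => hO.eq_of_src a b⟩
    (fun g hg => ⟨0, by simpa using hg.symm⟩)

/-- The conflation `O ⟶ X = X` for a zero object `O`. -/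
lemma conflation_id_right (X : C) {O : C} (hO : IsZero O) :
    E.conflation (ShortComplex.mk (0 : O ⟶ X) (𝟙 X) zero_comp) :=
  conflation_of_isDeflation _ _ _ (E.id_deflation X) ⟨fun a b _ => hO.eq_of_tgt a b⟩
    (fun g hg => ⟨0, by simpa using hg.symm⟩)

/-- The conflation given by an isomorphism, with a zero right-hand end term. -/
lemma conflation_iso_left {X Y : C} (e : X ≅ Y) {O : C} (hO : IsZero O) :
    E.conflation (ShortComplex.mk e.hom (0 : Y ⟶ O) comp_zero) :=
  E.of_iso (ShortComplex.isoMk (S₁ := ShortComplex.mk (𝟙 X) (0 : X ⟶ O) comp_zero)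
    (Iso.refl X) e (Iso.refl O) (by simp) (by simp)) (conflation_id_left X hO)

/-- The split conflation with given end terms. -/
lemma exists_split (E : ExactStructure C) (X Y : C) :
    ∃ (α : ShortExt E.conflation X Y) (r : α.mid ⟶ Y) (s : X ⟶ α.mid),
      α.i ≫ r = 𝟙 Y ∧ s ≫ α.p = 𝟙 X ∧ s ≫ r = 0 ∧ r ≫ α.i + α.p ≫ s = 𝟙 α.mid := by
  obtain ⟨O, hO⟩ := exists_isZero E X
  let ζ : ShortExt E.conflation O Y := ⟨Y, 𝟙 Y, 0, _, conflation_id_left Y hO⟩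
  obtain ⟨β, a, h, ha⟩ := exists_pullback ζ (0 : X ⟶ O)
  have h₁ : h.lift 0 (𝟙 X) (by simp) ≫ a = 0 := h.lift_fst _ _ _
  have h₂ : h.lift 0 (𝟙 X) (by simp) ≫ β.p = 𝟙 X := h.lift_snd _ _ _
  refine ⟨β, a, h.lift 0 (𝟙 X) (by simp), ha, h₂, h₁, h.hom_ext ?_ ?_⟩
  · rw [Preadditive.add_comp, Category.assoc, Category.assoc, h₁, ha]
    simp [ζ]
  · rw [Preadditive.add_comp, Category.assoc, Category.assoc, h₂, β.w]
    simp

end Conflations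

/-! ### Vanishing of Yoneda extension classes -/

section Null

variable {C : Type u} [Category.{v} C] [Preadditive C] {E : ExactStructure C}

/-- `Null k f ξ`: the class `f^* ξ` in `Ext^{k+1}(W, Y)` vanishes. In degree one this says that `f`
lifts to the middle term; in higher degrees, for `ξ` the splice of `α` and `β`, it says that
`f^* α = z_* α'` for some `α'` and some `z` such that `z^* β` vanishes. -/
def Null (σ : ObjectProperty (ShortComplex C)) :
    ∀ (k : ℕ) {W X Y : C}, (W ⟶ X) → NExt σ k X Y → Prop
  | 0, _, _, _, f, (ξ : ShortExt σ _ _) => ∃ l : _ ⟶ ξ.mid, l ≫ ξ.p = f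
  | k + 1, W, _, _, f, ⟨Z, α, β⟩ =>
      ∃ (Z' : C) (α' : ShortExt σ W Z') (z : Z' ⟶ Z) (a : α'.mid ⟶ α.mid),
        α'.i ≫ a = z ≫ α.i ∧ a ≫ α.p = α'.p ≫ f ∧ Null σ k z β

lemma Null.precomp : ∀ {k : ℕ} {V W X Y : C} (h : V ⟶ W) {f : W ⟶ X}
    {ξ : NExt E.conflation k X Y}, Null E.conflation k f ξ → Null E.conflation k (h ≫ f) ξ
  | 0, _, _, _, _, h, _, _, ⟨l, hl⟩ => ⟨h ≫ l, by simp [hl]⟩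
  | k + 1, _, _, _, _, h, f, ⟨Z, α, β⟩, ⟨Z', α', z, a, h₁, h₂, h₃⟩ => by
    obtain ⟨α'', b, hb, hb'⟩ := exists_pullback α' h
    exact ⟨Z', α'', z, b ≫ a, by rw [reassoc_of% hb', h₁],
      by rw [Category.assoc, h₂, reassoc_of% hb.w], h₃⟩

lemma Null.map : ∀ {k : ℕ} {W X X' Y : C} {f : W ⟶ X} {g : X ⟶ X'}
    {ξ : NExt E.conflation k X Y} {η : NExt E.conflation k X' Y},
    NExt.Map E.conflation k g ξ η → Null E.conflation k f ξ → Null E.conflation k (f ≫ g) η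
  | 0, _, _, _, _, f, g, _, _, ⟨a, _, h₂⟩, ⟨l, hl⟩ => ⟨l ≫ a, by
      rw [Category.assoc, h₂, reassoc_of% hl]⟩
  | k + 1, _, _, _, _, f, g, ⟨Z, α, β⟩, ⟨Z₂, α₂, β₂⟩, ⟨z, a, h₁, h₂, h₃⟩,
      ⟨Z', α', z', a', h₁', h₂', h₃'⟩ =>
    ⟨Z', α', z' ≫ z, a' ≫ a, by rw [reassoc_of% h₁', h₁, Category.assoc],
      by rw [Category.assoc, h₂, reassoc_of% h₂'], h₃'.map h₃⟩

/-- Every class is effaced by a deflation. -/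
lemma exists_deflation_null : ∀ {k : ℕ} {X Y : C} (ξ : NExt E.conflation k X Y),
    ∃ (M : C) (e : M ⟶ X), IsDeflation E.conflation e ∧ Null E.conflation k e ξ
  | 0, _, _, ξ => ⟨ξ.mid, ξ.p, ξ.isDeflation, 𝟙 _, by simp⟩
  | k + 1, _, _, ⟨Z, α, β⟩ => by
    obtain ⟨O, hO⟩ := exists_isZero E Z
    obtain ⟨M, e, he, hβ⟩ := exists_deflation_null β
    refine ⟨α.mid, α.p, α.isDeflation, O, ⟨_, _, _, _, conflation_id_right α.mid hO⟩, 0, 𝟙 _,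
      by simp, by simp, ?_⟩
    simpa using hβ.precomp (0 : O ⟶ M)

lemma Null.zero {k : ℕ} {W X Y : C} (ξ : NExt E.conflation k X Y) :
    Null E.conflation k (0 : W ⟶ X) ξ := by
  obtain ⟨M, e, he, hξ⟩ := exists_deflation_null ξ
  simpa using hξ.precomp (0 : W ⟶ M)

lemma Null.add : ∀ {k : ℕ} {W X Y : C} {f g : W ⟶ X} {ξ : NExt E.conflation k X Y},
    Null E.conflation k f ξ → Null E.conflation k g ξ → Null E.conflation k (f + g) ξ
  | 0, _, _, _, _, _, _, ⟨l, hl⟩, ⟨l', hl'⟩ => ⟨l + l', by simp [hl, hl']⟩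
  | k + 1, W, _, _, f, g, ⟨Z, α, β⟩, ⟨Z₁, α₁, z₁, a₁, h₁, h₁', n₁⟩,
      ⟨Z₂, α₂, z₂, a₂, h₂, h₂', n₂⟩ => by
    have := α.mono_i
    obtain ⟨π, b, hb, hb'⟩ := exists_pullback α₁ α₂.p
    obtain ⟨K, κ, w, hκ⟩ := E.comp_deflation _ _ π.isDeflation α₂.isDeflation
    obtain ⟨t₁, ht₁⟩ := α₁.exists_lift (κ ≫ b) (by rw [Category.assoc, hb.w, w])
    obtain ⟨t₂, ht₂⟩ := α₂.exists_lift (κ ≫ π.p) (by rw [Category.assoc, w])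
    refine ⟨K, ⟨π.mid, κ, π.p ≫ α₂.p, w, hκ⟩, t₁ ≫ z₁ + t₂ ≫ z₂, b ≫ a₁ + π.p ≫ a₂, ?_, ?_,
      (n₁.precomp t₁).add (n₂.precomp t₂)⟩
    · simp only [Preadditive.comp_add, Preadditive.add_comp, Category.assoc, ← h₁, ← h₂,
        reassoc_of% ht₁, reassoc_of% ht₂]
    · simp only [Preadditive.comp_add, Preadditive.add_comp, Category.assoc, h₁', h₂',
        reassoc_of% hb.w]

lemma Null.neg {k : ℕ} {W X Y : C} {f : W ⟶ X} {ξ : NExt E.conflation k X Y}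
    (h : Null E.conflation k f ξ) : Null E.conflation k (-f) ξ := by
  simpa using h.precomp (-𝟙 W)

/-- If a morphism `ξ ⟶ η` over `g` is the identity on the left-hand ends, then `ξ = g^* η`, so that
`f^* ξ` vanishes as soon as `(f ≫ g)^* η` does. -/
lemma Null.of_map : ∀ {k : ℕ} {W X X' Y : C} {f : W ⟶ X} {g : X ⟶ X'}
    {ξ : NExt E.conflation k X Y} {η : NExt E.conflation k X' Y},
    NExt.Map E.conflation k g ξ η → Null E.conflation k (f ≫ g) η → Null E.conflation k f ξ
  | 0, W, _, _, _, f, g, ξ, η, ⟨a, h₁, h₂⟩, ⟨l, hl⟩ => by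
    have := ShortExt.mono_i η
    obtain ⟨ζ, b, hb, hb'⟩ := exists_pullback ξ f
    have := ζ.epi_p
    obtain ⟨c, hc⟩ := ShortExt.exists_lift η (b ≫ a - ζ.p ≫ l) (by
      simp [h₂, hl, reassoc_of% hb.w])
    have hc' : ζ.i ≫ c = 𝟙 _ := by
      rw [← cancel_mono η.i, Category.assoc, hc]
      simp [reassoc_of% hb', h₁, reassoc_of% ζ.w]
    obtain ⟨m, hm⟩ := ζ.exists_desc (b - c ≫ ξ.i) (by simp [hb', reassoc_of% hc'])
    refine ⟨m, ?_⟩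
    rw [← cancel_epi ζ.p, reassoc_of% hm]
    simp [ξ.w, hb.w]
  | k + 1, W, _, _, _, f, g, ⟨Z₁, α₁, β₁⟩, ⟨Z₂, α₂, β₂⟩, ⟨z, a, h₁, h₂, hβ⟩,
      ⟨Z', α', z', a', h₁', h₂', n⟩ => by
    have := α₂.mono_i
    obtain ⟨ζ, b, hb, hb'⟩ := exists_pullback α₁ f
    obtain ⟨π, e, he, he'⟩ := exists_pullback α' ζ.p
    -- The two morphisms from the fibre product to the middle term of `α₂` differ by `c`; the
    -- class `c^* β₂` need not vanish, but it does after a further deflation `τ.p`.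
    obtain ⟨c, hc⟩ := α₂.exists_lift (π.p ≫ b ≫ a - e ≫ a') (by
      simp [h₂, h₂', reassoc_of% hb.w, reassoc_of% he.w])
    obtain ⟨H, ε, hε, nε⟩ := exists_deflation_null β₂
    obtain ⟨L, j, wj, hj⟩ := hε
    obtain ⟨τ, c', hc', -⟩ := exists_pullback (⟨H, j, ε, wj, hj⟩ : ShortExt E.conflation Z₂ L) c
    obtain ⟨K, κ, w, hκ⟩ := E.comp_deflation _ _ τ.isDeflation
      (E.comp_deflation _ _ π.isDeflation ζ.isDeflation)
    obtain ⟨x, hx⟩ := ζ.exists_lift (κ ≫ τ.p ≫ π.p) (by simpa using w)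
    obtain ⟨y, hy⟩ := α'.exists_lift (κ ≫ τ.p ≫ e) (by simpa [he.w] using w)
    have hx' : x ≫ α₁.i = κ ≫ τ.p ≫ π.p ≫ b := by
      rw [← hb', reassoc_of% hx]
    refine ⟨K, ⟨τ.mid, κ, _, w, hκ⟩, x, τ.p ≫ π.p ≫ b, by simp [hx'], by simp [hb.w], ?_⟩
    refine Null.of_map hβ ?_
    have hxz : x ≫ z = (κ ≫ c') ≫ ε + y ≫ z' := by
      have hc'w : c' ≫ ε = τ.p ≫ c := hc'.w
      rw [← cancel_mono α₂.i, Category.assoc, ← h₁, reassoc_of% hx']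
      simp only [Preadditive.add_comp, Category.assoc, reassoc_of% hc'w, ← h₁', reassoc_of% hy, hc,
        Preadditive.comp_sub]
      abel
    rw [hxz]
    exact (nε.precomp _).add (n.precomp y)

/-! ### Base change of extensions -/

/-- `Equiv k ξ η`: the exact sequences `ξ` and `η` have the same class in `Ext^{k+1}(X, Y)`. -/
def Equiv (σ : ObjectProperty (ShortComplex C)) (k : ℕ) {X Y : C} (ξ η : NExt σ k X Y) : Prop :=
  Relation.EqvGen (fun ξ η : NExt σ k X Y => NExt.Map σ k (𝟙 X) ξ η) ξ η

lemma Equiv.of_map {σ : ObjectProperty (ShortComplex C)} {k : ℕ} {X Y : C} {ξ η : NExt σ k X Y}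
    (h : NExt.Map σ k (𝟙 X) ξ η) : Equiv σ k ξ η := .rel _ _ h

lemma Equiv.symm {σ : ObjectProperty (ShortComplex C)} {k : ℕ} {X Y : C} {ξ η : NExt σ k X Y}
    (h : Equiv σ k ξ η) : Equiv σ k η ξ := Relation.EqvGen.symm _ _ h

lemma Equiv.trans {σ : ObjectProperty (ShortComplex C)} {k : ℕ} {X Y : C}
    {ξ η ζ : NExt σ k X Y} (h : Equiv σ k ξ η) (h' : Equiv σ k η ζ) : Equiv σ k ξ ζ :=
  Relation.EqvGen.trans _ _ _ h h'

lemma NExt.Map.refl {σ : ObjectProperty (ShortComplex C)} :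
    ∀ {k : ℕ} {X Y : C} (ξ : NExt σ k X Y), NExt.Map σ k (𝟙 X) ξ ξ
  | 0, _, _, _ => ⟨𝟙 _, by simp, by simp⟩
  | _ + 1, _, _, ⟨_, _, β⟩ => ⟨𝟙 _, 𝟙 _, by simp, by simp, NExt.Map.refl β⟩

lemma NExt.Map.comp {σ : ObjectProperty (ShortComplex C)} :
    ∀ {k : ℕ} {X X' X'' Y : C} {f : X ⟶ X'} {g : X' ⟶ X''} {ξ : NExt σ k X Y} {η : NExt σ k X' Y}
      {ζ : NExt σ k X'' Y}, NExt.Map σ k f ξ η → NExt.Map σ k g η ζ → NExt.Map σ k (f ≫ g) ξ ζ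
  | 0, _, _, _, _, _, _, _, _, _, ⟨a, h₁, h₂⟩, ⟨b, h₁', h₂'⟩ =>
    ⟨a ≫ b, by rw [reassoc_of% h₁, h₁'], by rw [Category.assoc, h₂', reassoc_of% h₂]⟩
  | _ + 1, _, _, _, _, _, _, ⟨_, _, _⟩, ⟨_, _, _⟩, ⟨_, _, _⟩, ⟨z, a, h₁, h₂, h₃⟩,
      ⟨z', b, h₁', h₂', h₃'⟩ =>
    ⟨z ≫ z', a ≫ b, by rw [reassoc_of% h₁, h₁', Category.assoc],
      by rw [Category.assoc, h₂', reassoc_of% h₂], h₃.comp h₃'⟩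

lemma Equiv.refl {σ : ObjectProperty (ShortComplex C)} {k : ℕ} {X Y : C} (ξ : NExt σ k X Y) :
    Equiv σ k ξ ξ := .of_map (.refl ξ)

/-- The base change `f^* ξ`, obtained from a base change of the right-hand conflation. -/
noncomputable def pull : ∀ (k : ℕ) {W X Y : C}, (W ⟶ X) → NExt E.conflation k X Y →
    NExt E.conflation k W Y
  | 0, _, _, _, f, ξ => (exists_pullback (E := E) ξ f).choose
  | _ + 1, _, _, _, f, ⟨Z, α, β⟩ => ⟨Z, (exists_pullback α f).choose, β⟩

lemma map_pull : ∀ (k : ℕ) {W X Y : C} (f : W ⟶ X) (ξ : NExt E.conflation k X Y),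
    NExt.Map E.conflation k f (pull k f ξ) ξ
  | 0, _, _, _, f, ξ => by
    obtain ⟨a, h, h'⟩ := (exists_pullback (E := E) ξ f).choose_spec
    exact ⟨a, h', h.w⟩
  | _ + 1, _, _, _, f, ⟨Z, α, β⟩ => by
    obtain ⟨a, h, h'⟩ := (exists_pullback (E := E) α f).choose_spec
    exact ⟨𝟙 Z, a, by rw [Category.id_comp]; exact h', h.w, .refl β⟩

/-- The universal property of the base change. -/
lemma map_pull_of_map : ∀ {k : ℕ} {V W X Y : C} {g : V ⟶ W} {f : W ⟶ X}
    {ξ : NExt E.conflation k X Y} {η : NExt E.conflation k V Y},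
    NExt.Map E.conflation k (g ≫ f) η ξ → NExt.Map E.conflation k g η (pull k f ξ)
  | 0, _, _, _, _, g, f, ξ, η, ⟨b, h₁, h₂⟩ => by
    obtain ⟨a, h, h'⟩ := (exists_pullback (E := E) ξ f).choose_spec
    have w := (exists_pullback (E := E) ξ f).choose.w
    have hη := ShortExt.w η
    have hl : b ≫ ξ.p = (η.p ≫ g) ≫ f := by rw [h₂, Category.assoc]
    have h₃ : η.i ≫ h.lift b (η.p ≫ g) hl = (exists_pullback (E := E) ξ f).choose.i := by
      refine h.hom_ext ?_ ?_
      · rw [Category.assoc, h.lift_fst, h₁, h']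
      · rw [Category.assoc, h.lift_snd, reassoc_of% hη, zero_comp, w]
    exact ⟨_, h₃, h.lift_snd _ _ _⟩
  | _ + 1, _, _, _, _, g, f, ⟨Z, α, β⟩, ⟨Z', α', β'⟩, ⟨z, b, h₁, h₂, h₃⟩ => by
    obtain ⟨a, h, h'⟩ := (exists_pullback (E := E) α f).choose_spec
    have w := (exists_pullback (E := E) α f).choose.w
    refine ⟨z, h.lift b (α'.p ≫ g) (by rw [h₂, Category.assoc]), h.hom_ext ?_ ?_,
      h.lift_snd _ _ _, h₃⟩
    · simp only [Category.assoc, h.lift_fst]; rw [h₁, h']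
    · simp only [Category.assoc, h.lift_snd]
      rw [reassoc_of% α'.w, zero_comp, w, comp_zero]

lemma Equiv.of_map_pull {k : ℕ} {W X Y : C} {f : W ⟶ X} {ξ : NExt E.conflation k X Y}
    {η : NExt E.conflation k W Y} (h : NExt.Map E.conflation k f η ξ) :
    Equiv E.conflation k η (pull k f ξ) :=
  .of_map (map_pull_of_map (by simpa using h))

lemma Equiv.pull {k : ℕ} {W X Y : C} (f : W ⟶ X) {ξ η : NExt E.conflation k X Y}
    (h : Equiv E.conflation k ξ η) :
    Equiv E.conflation k (ExactCat.pull k f ξ) (ExactCat.pull k f η) := by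
  induction h with
  | rel ξ η h => exact .of_map_pull (by simpa using (map_pull k f ξ).comp h)
  | refl ξ => exact .refl _
  | symm ξ η _ ih => exact ih.symm
  | trans ξ η ζ _ _ ih ih' => exact ih.trans ih'

lemma pull_pull_equiv {k : ℕ} {V W X Y : C} (g : V ⟶ W) (f : W ⟶ X)
    (ξ : NExt E.conflation k X Y) :
    Equiv E.conflation k (pull k g (pull k f ξ)) (pull k (g ≫ f) ξ) :=
  .of_map_pull ((map_pull k g _).comp (map_pull k f ξ))

lemma pull_id_equiv {k : ℕ} {X Y : C} (ξ : NExt E.conflation k X Y) :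
    Equiv E.conflation k (pull k (𝟙 X) ξ) ξ :=
  .of_map (map_pull k _ ξ)

lemma Equiv.splice {σ : ObjectProperty (ShortComplex C)} {k : ℕ} {X Y Z : C} (α : ShortExt σ X Z)
    {ξ η : NExt σ k Z Y} (h : Equiv σ k ξ η) :
    Equiv σ (k + 1) (⟨Z, α, ξ⟩ : NExt σ (k + 1) X Y) ⟨Z, α, η⟩ := by
  induction h with
  | rel ξ η h => exact .of_map ⟨𝟙 _, 𝟙 _, by simp, by simp, h⟩
  | refl ξ => exact .refl _
  | symm ξ η _ ih => exact ih.symm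
  | trans ξ η ζ _ _ ih ih' => exact ih.trans ih'

lemma Equiv.null_iff {k : ℕ} {W X Y : C} {f : W ⟶ X} {ξ η : NExt E.conflation k X Y}
    (h : Equiv E.conflation k ξ η) : Null E.conflation k f ξ ↔ Null E.conflation k f η := by
  induction h with
  | rel ξ η h => exact ⟨fun n => by simpa using n.map h, fun n => .of_map h (by simpa using n)⟩
  | refl ξ => exact Iff.rfl
  | symm ξ η _ ih => exact ih.symm
  | trans ξ η ζ _ _ ih ih' => exact ih.trans ih'

lemma null_pull_iff {k : ℕ} {V W X Y : C} {g : V ⟶ W} {f : W ⟶ X} {ξ : NExt E.conflation k X Y} :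
    Null E.conflation k g (pull k f ξ) ↔ Null E.conflation k (g ≫ f) ξ :=
  ⟨fun n => n.map (map_pull k f ξ), fun n => .of_map (map_pull k f ξ) n⟩

/-! ### Extension groups vanish if and only if all classes are null -/

/-- The exact sequence `Y = Y ⟶ O ⟶ ⋯ ⟶ O` for a zero object `O`. -/
def zeroExt (E : ExactStructure C) {O : C} (hO : IsZero O) (Y : C) :
    ∀ k : ℕ, NExt E.conflation k O Y
  | 0 => ⟨Y, _, _, _, conflation_id_left Y hO⟩
  | k + 1 => ⟨O, ⟨O, _, _, _, conflation_id_left O hO⟩, zeroExt E hO Y k⟩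

/-- If `f^* ξ` vanishes, there is an exact sequence with maps both to `ξ` over `f` and to the
trivial sequence. -/
lemma Null.exists_map {O : C} (hO : IsZero O) : ∀ {k : ℕ} {W X Y : C} {f : W ⟶ X}
    {ξ : NExt E.conflation k X Y}, Null E.conflation k f ξ →
    ∃ ρ : NExt E.conflation k W Y, NExt.Map E.conflation k f ρ ξ ∧
      NExt.Map E.conflation k 0 ρ (zeroExt E hO Y k)
  | 0, W, _, Y, f, (ξ : ShortExt _ _ _), ⟨l, hl⟩ => by
    obtain ⟨α, r, -, hr, -⟩ := exists_split E W Y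
    exact ⟨α, ⟨r ≫ ξ.i + α.p ≫ l, by simp [reassoc_of% hr, reassoc_of% α.w], by simp [ξ.w, hl]⟩,
      r, hr, hO.eq_of_tgt _ _⟩
  | k + 1, _, _, _, f, ⟨Z, α, β⟩, ⟨Z', α', z, a, h₁, h₂, n⟩ => by
    obtain ⟨ρ, h, h'⟩ := n.exists_map hO
    exact ⟨⟨Z', α', ρ⟩, ⟨z, a, h₁, h₂, h⟩, 0, 0, by simp, hO.eq_of_tgt _ _, h'⟩

lemma Null.equiv {k : ℕ} {X Y : C} {ξ η : NExt E.conflation k X Y}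
    (hξ : Null E.conflation k (𝟙 X) ξ) (hη : Null E.conflation k (𝟙 X) η) :
    Equiv E.conflation k ξ η := by
  obtain ⟨O, hO⟩ := exists_isZero E X
  obtain ⟨ρ, h₁, h₂⟩ := hξ.exists_map hO
  obtain ⟨ρ', h₁', h₂'⟩ := hη.exists_map hO
  exact ((Equiv.of_map h₁).symm.trans (.of_map_pull h₂)).trans
    ((Equiv.of_map_pull h₂').symm.trans (.of_map h₁'))

/-- `Ext^{k+1}(X, Y) = 0` if and only if every exact sequence is null in the recursive sense. -/
theorem extVanish_succ_iff {k : ℕ} {X Y : C} : ExtVanish E.conflation (k + 1) X Y ↔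
    ∀ ξ : NExt E.conflation k X Y, Null E.conflation k (𝟙 X) ξ := by
  constructor
  · intro h ξ
    obtain ⟨O, hO⟩ := exists_isZero E X
    let η := pull k (0 : X ⟶ O) (zeroExt E hO Y k)
    have hη : Null E.conflation k (𝟙 X) η := null_pull_iff.2 (by simpa using Null.zero _)
    have : Subsingleton (Quot fun ξ η : NExt E.conflation k X Y =>
      NExt.Map E.conflation k (𝟙 X) ξ η) := h
    have h' : Equiv E.conflation k ξ η :=
      Quot.eqvGen_exact (Subsingleton.elim (Quot.mk _ ξ) (Quot.mk _ η))
    exact h'.null_iff.2 hη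
  · intro h
    change Subsingleton (Quot fun ξ η : NExt E.conflation k X Y =>
      NExt.Map E.conflation k (𝟙 X) ξ η)
    refine ⟨fun x y => ?_⟩
    induction x using Quot.ind with | _ ξ
    induction y using Quot.ind with | _ η
    exact Quot.eqvGen_sound ((h ξ).equiv (h η))

end Null

/-! ### Exactness of the contravariant long Ext-sequence -/

section LongExact

variable {C : Type u} [Category.{v} C] [Preadditive C] {E : ExactStructure C}

/-- Exactness at the sub-object, granted exactness at the middle term in the same degree: for a
conflation `A ⟶ B ⟶ Q`, a class on `A` with vanishing connecting image extends to `B`. The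
hypothesis is discharged by `exists_equiv_pull_of_null`. -/
lemma exists_equiv_pull_of_null_splice_aux {k : ℕ} {A Q Y : C}
    (hk : ∀ {A B Q : C} (i : A ⟶ B) (q : B ⟶ Q) (w : i ≫ q = 0),
      E.conflation (ShortComplex.mk i q w) → ∀ ξ : NExt E.conflation k B Y,
      Null E.conflation k i ξ → ∃ γ : NExt E.conflation k Q Y,
        Equiv E.conflation k ξ (pull k q γ))
    (ε : ShortExt E.conflation Q A) (ξ : NExt E.conflation k A Y)
    (h : Null E.conflation (k + 1) (𝟙 Q) (⟨A, ε, ξ⟩ : NExt E.conflation (k + 1) Q Y)) :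
    ∃ γ : NExt E.conflation k ε.mid Y, Equiv E.conflation k ξ (pull k ε.i γ) := by
  obtain ⟨Z', α', z, a, h₁, h₂, n⟩ := h
  have := ε.mono_i
  obtain ⟨π, b, hb, hb'⟩ := exists_pullback α' ε.p
  -- The fibre product `π.mid` is split over the middle term of `α'`, with projection `r` to `A`.
  obtain ⟨r, hr⟩ := ε.exists_lift (π.p - b ≫ a) (by simp [h₂, hb.w])
  have hπr : π.i ≫ r = -z := by
    rw [← cancel_mono ε.i, Category.assoc, hr]
    simp [reassoc_of% hb', h₁, π.w]
  obtain ⟨γ, hγ⟩ := hk π.i π.p π.w π.mem (pull k r ξ) (null_pull_iff.2 (by rw [hπr]; exact n.neg))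
  let s : A ⟶ π.mid := hb.lift 0 ε.i (by simp [ε.w])
  have hs : s ≫ π.p = ε.i := hb.lift_snd _ _ _
  have hsr : s ≫ r = 𝟙 A := by
    have hs' : s ≫ b = 0 := hb.lift_fst _ _ _
    rw [← cancel_mono ε.i, Category.assoc, hr]
    simp [hs, reassoc_of% hs']
  refine ⟨γ, ?_⟩
  have h₃ := (pull_pull_equiv s r ξ).symm.trans ((hγ.pull s).trans (pull_pull_equiv s π.p γ))
  rw [hs, hsr] at h₃
  exact (pull_id_equiv ξ).symm.trans h₃

/-- Exactness at the middle term: for a conflation `A ⟶ B ⟶ Q`, a class on `B` that restricts to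
zero on `A` comes from `Q`. -/
lemma exists_equiv_pull_of_null : ∀ {k : ℕ} {A B Q Y : C} (i : A ⟶ B) (q : B ⟶ Q) (w : i ≫ q = 0),
    E.conflation (ShortComplex.mk i q w) → ∀ ξ : NExt E.conflation k B Y,
    Null E.conflation k i ξ → ∃ γ : NExt E.conflation k Q Y,
      Equiv E.conflation k ξ (pull k q γ)
  | 0, A, B, Q, Y, i, q, w, hε, (ξ : ShortExt E.conflation B Y), ⟨l, hl⟩ => by
    have := ξ.mono_i
    obtain ⟨β, c, w', h₁, h₂, -, h₃⟩ := exists_kernel_comp ξ i q w hε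
    obtain ⟨r, hr⟩ := ξ.exists_lift (c - β.p ≫ l) (by simp [h₂, hl])
    have hβr : β.i ≫ r = 𝟙 _ := by
      rw [← cancel_mono ξ.i, Category.assoc, hr]
      simp [h₁, reassoc_of% β.w]
    obtain ⟨γ, g, hg, hg'⟩ := exists_pushout
      (⟨ξ.mid, c, ξ.p ≫ q, w', h₃⟩ : ShortExt E.conflation Q β.mid) r
    have hgw : c ≫ g = r ≫ γ.i := hg.w
    refine ⟨γ, .of_map_pull (k := 0) ⟨g, ?_, hg'⟩⟩
    rw [← h₁, Category.assoc, hgw, reassoc_of% hβr]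
  | k + 1, A, B, Q, Y, i, q, w, hε, ⟨Z, α, ξ⟩, n => by
    obtain ⟨β, c, w', h₁, h₂, -, h₃⟩ := exists_kernel_comp α i q w hε
    have n' : Null E.conflation (k + 1) (𝟙 A) (⟨Z, β, ξ⟩ : NExt E.conflation (k + 1) A Y) := by
      refine .of_map (g := i) (η := (⟨Z, α, ξ⟩ : NExt E.conflation (k + 1) B Y))
        ⟨𝟙 Z, c, by simpa using h₁, h₂, .refl ξ⟩ (by simpa using n)
    obtain ⟨γ, hγ⟩ := exists_equiv_pull_of_null_splice_aux exists_equiv_pull_of_null β ξ n'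
    refine ⟨⟨β.mid, ⟨α.mid, c, α.p ≫ q, w', h₃⟩, γ⟩, (hγ.splice α).trans (.of_map_pull ?_)⟩
    exact ⟨β.i, 𝟙 _, by simp [h₁], by simp, map_pull k _ _⟩

/-- Exactness at the sub-object: for a conflation `A ⟶ B ⟶ Q`, a class on `A` with vanishing
connecting image extends to `B`. -/
lemma exists_equiv_pull_of_null_splice {k : ℕ} {A Q Y : C} (ε : ShortExt E.conflation Q A)
    (ξ : NExt E.conflation k A Y)
    (h : Null E.conflation (k + 1) (𝟙 Q) (⟨A, ε, ξ⟩ : NExt E.conflation (k + 1) Q Y)) :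
    ∃ γ : NExt E.conflation k ε.mid Y, Equiv E.conflation k ξ (pull k ε.i γ) :=
  exists_equiv_pull_of_null_splice_aux exists_equiv_pull_of_null ε ξ h

/-- Exactness at the quotient: for a conflation `A ⟶ B ⟶ Q`, a class on `Q` that vanishes on `B` is
the connecting image of a class on `A`. -/
lemma exists_equiv_splice_of_null {k : ℕ} {A Q Y : C} (ε : ShortExt E.conflation Q A)
    (ξ : NExt E.conflation (k + 1) Q Y) (h : Null E.conflation (k + 1) ε.p ξ) :
    ∃ ω : NExt E.conflation k A Y,
      Equiv E.conflation (k + 1) ξ (⟨A, ε, ω⟩ : NExt E.conflation (k + 1) Q Y) := by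
  obtain ⟨Z, α, β⟩ := ξ
  obtain ⟨Z', α', z, a, h₁, h₂, n⟩ := h
  have := α.mono_i
  obtain ⟨δ, c, w', h₃, h₄, -, h₅⟩ := exists_kernel_comp α' ε.i ε.p ε.w ε.mem
  obtain ⟨t, ht⟩ := α.exists_lift (c ≫ a) (by simp [h₂, w'])
  have hδt : δ.i ≫ t = z := by
    rw [← cancel_mono α.i, Category.assoc, ht, reassoc_of% h₃, h₁]
  obtain ⟨ω, hω⟩ := exists_equiv_pull_of_null δ.i δ.p δ.w δ.mem (pull k t β)
    (null_pull_iff.2 (by rwa [hδt]))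
  let τ : ShortExt E.conflation Q δ.mid := ⟨α'.mid, c, α'.p ≫ ε.p, w', h₅⟩
  refine ⟨ω, Equiv.trans (Equiv.symm
    (.of_map (σ := E.conflation) (k := k + 1) (X := Q) (Y := Y) (ξ := ⟨δ.mid, τ, pull k t β⟩) ?_))
    ((hω.splice τ).trans (.of_map ?_))⟩
  · exact ⟨t, a, ht.symm, by simpa [τ] using h₂, map_pull k _ _⟩
  · exact ⟨δ.p, α'.p, h₄, by simp [τ], map_pull k _ _⟩

/-! ### Dimension shifting -/

/-- Dimension shifting to the sub-object of a conflation, in the first variable. -/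
theorem extVanish_left {k : ℕ} {A Q Y : C} (ε : ShortExt E.conflation Q A)
    (hB : ExtVanish E.conflation (k + 1) ε.mid Y) (hQ : ExtVanish E.conflation (k + 2) Q Y) :
    ExtVanish E.conflation (k + 1) A Y := by
  rw [extVanish_succ_iff] at *
  intro ξ
  obtain ⟨γ, hγ⟩ := exists_equiv_pull_of_null_splice ε ξ (hQ _)
  rw [hγ.null_iff, null_pull_iff]
  simpa using (hB γ).precomp ε.i

lemma Null.splice {k : ℕ} {X Y Z : C} (α : ShortExt E.conflation X Z) {ξ : NExt E.conflation k Z Y}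
    (h : Null E.conflation k (𝟙 Z) ξ) :
    Null E.conflation (k + 1) (𝟙 X) (⟨Z, α, ξ⟩ : NExt E.conflation (k + 1) X Y) :=
  ⟨Z, α, 𝟙 Z, 𝟙 _, by simp, by simp, h⟩

/-- Dimension shifting to the quotient of a conflation, in the first variable. -/
theorem extVanish_right {k : ℕ} {A Q Y : C} (ε : ShortExt E.conflation Q A)
    (hA : ExtVanish E.conflation (k + 1) A Y) (hB : ExtVanish E.conflation (k + 2) ε.mid Y) :
    ExtVanish E.conflation (k + 2) Q Y := by
  rw [extVanish_succ_iff] at *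
  intro ξ
  obtain ⟨ω, hω⟩ := exists_equiv_splice_of_null ε ξ
    (by simpa using null_pull_iff.1 (hB (pull (k + 1) ε.p ξ)))
  exact hω.null_iff.2 ((hA ω).splice ε)

/-- The push-forward `y_* ξ`, obtained from a cobase change of the left-hand conflation. -/
noncomputable def push {Y Y' : C} (y : Y ⟶ Y') : ∀ (k : ℕ) {X : C}, NExt E.conflation k X Y →
    NExt E.conflation k X Y'
  | 0, _, ξ => (exists_pushout (E := E) ξ y).choose
  | k + 1, _, ⟨Z, α, β⟩ => ⟨Z, α, push y k β⟩

/-- The splice of an exact sequence with a conflation on its left-hand side. -/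
def spliceLeft {σ : ObjectProperty (ShortComplex C)} {Q Y : C} (κ : ShortExt σ Q Y) :
    ∀ (k : ℕ) {X : C}, NExt σ k X Q → NExt σ (k + 1) X Y
  | 0, _, η => ⟨Q, η, κ⟩
  | k + 1, _, ⟨Z, α, β⟩ => ⟨Z, α, spliceLeft κ k β⟩

lemma exists_eq_spliceLeft {σ : ObjectProperty (ShortComplex C)} {Y : C} :
    ∀ {k : ℕ} {X : C} (ξ : NExt σ (k + 1) X Y),
      ∃ (Q : C) (κ : ShortExt σ Q Y) (η : NExt σ k X Q), ξ = spliceLeft κ k η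
  | 0, _, ⟨Q, η, κ⟩ => ⟨Q, κ, η, rfl⟩
  | k + 1, _, ⟨Z, α, β⟩ => by
    obtain ⟨Q, κ, η, rfl⟩ := exists_eq_spliceLeft β
    exact ⟨Q, κ, ⟨Z, α, η⟩, rfl⟩

lemma Null.spliceLeft {Q Y : C} (κ : ShortExt E.conflation Q Y) :
    ∀ {k : ℕ} {W X : C} {f : W ⟶ X} {η : NExt E.conflation k X Q}, Null E.conflation k f η →
      Null E.conflation (k + 1) f (ExactCat.spliceLeft κ k η)
  | 0, W, X, f, (η : ShortExt _ _ _), ⟨l, hl⟩ => by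
    obtain ⟨O, hO⟩ := exists_isZero E W
    exact ⟨O, ⟨_, _, _, _, conflation_id_right W hO⟩, 0, l, by simp, by simp [hl],
      Null.zero (k := 0) κ⟩
  | k + 1, _, _, _, ⟨Z, α, β⟩, ⟨Z', α', z, a, h₁, h₂, n⟩ => ⟨Z', α', z, a, h₁, h₂, n.spliceLeft κ⟩

/-- Exactness of the covariant sequence in degree one: a conflation whose push-forward to the middle
term of `κ` splits is a base change of `κ`. -/
lemma exists_map_of_null_push {Q Y W X : C} (κ : ShortExt E.conflation Q Y) {f : W ⟶ X}
    (ξ : NExt E.conflation 0 X Y) (n : Null E.conflation 0 f (push κ.i 0 ξ)) :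
    ∃ g : W ⟶ Q, NExt.Map E.conflation 0 g (pull 0 f ξ) κ := by
  obtain ⟨l, hl⟩ := n
  obtain ⟨b, hb, hb'⟩ := (exists_pushout (E := E) ξ κ.i).choose_spec
  obtain ⟨c, hc, hc'⟩ := map_pull 0 f ξ
  have key : ∀ (ξ β : ShortExt E.conflation X _) (ζ : ShortExt E.conflation W Y)
      (b : ξ.mid ⟶ β.mid) (c : ζ.mid ⟶ ξ.mid) (l : W ⟶ β.mid), ξ.i ≫ b = κ.i ≫ β.i →
      b ≫ β.p = ξ.p → ζ.i ≫ c = ξ.i → c ≫ ξ.p = ζ.p ≫ f → l ≫ β.p = f →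
      ∃ (g : W ⟶ Q) (h : ζ.mid ⟶ κ.mid), ζ.i ≫ h = κ.i ∧ h ≫ κ.p = ζ.p ≫ g := by
    intro ξ β ζ b c l hb hb' hc hc' hl
    have := β.mono_i
    obtain ⟨h, hh⟩ := β.exists_lift (c ≫ b - ζ.p ≫ l) (by simp [hb', hc', hl])
    have hi : ζ.i ≫ h = κ.i := by
      rw [← cancel_mono β.i, Category.assoc, hh]
      simp [reassoc_of% hc, hb, reassoc_of% ζ.w]
    obtain ⟨g, hg⟩ := ζ.exists_desc (h ≫ κ.p) (by rw [reassoc_of% hi, κ.w])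
    exact ⟨g, h, hi, hg.symm⟩
  exact key ξ _ _ b c l hb.w hb' hc hc' hl

/-- Exactness of the covariant long sequence: for a conflation `Y ⟶ B ⟶ Q`, a class whose
push-forward to `B` vanishes is the connecting image of a class with values in `Q`. -/
lemma exists_equiv_spliceLeft {Q Y : C} (κ : ShortExt E.conflation Q Y) : ∀ {k : ℕ} {W X : C}
    {f : W ⟶ X} (ξ : NExt E.conflation (k + 1) X Y),
    Null E.conflation (k + 1) f (push κ.i (k + 1) ξ) →
    ∃ η : NExt E.conflation k W Q,
      Equiv E.conflation (k + 1) (pull (k + 1) f ξ) (spliceLeft κ k η)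
  | 0, W, X, f, ⟨Z, α, β⟩, ⟨Z', α', z, a, h₁, h₂, n⟩ => by
    obtain ⟨g, hg⟩ := exists_map_of_null_push κ β n
    obtain ⟨η, b, hb, hb'⟩ := exists_pushout α' g
    refine ⟨η, Equiv.trans (Equiv.symm
      (.of_map_pull (E := E) (k := 1) (W := W) (Y := Y) (η := ⟨Z', α', pull 0 z β⟩) ?_))
      (.of_map ?_)⟩
    · exact ⟨z, a, h₁, h₂, map_pull 0 _ _⟩
    · exact ⟨g, b, hb.w, by simpa using hb', hg⟩
  | k + 1, W, X, f, ⟨Z, α, β⟩, ⟨Z', α', z, a, h₁, h₂, n⟩ => by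
    obtain ⟨η, hη⟩ := exists_equiv_spliceLeft κ β n
    refine ⟨⟨Z', α', η⟩, Equiv.trans (Equiv.symm
      (.of_map_pull (E := E) (k := k + 2) (W := W) (Y := Y) (η := ⟨Z', α', pull _ z β⟩) ?_))
      (hη.splice α')⟩
    exact ⟨z, a, h₁, h₂, map_pull _ _ _⟩

/-- Dimension shifting in the second variable. -/
theorem extVanish_second {k : ℕ} {Q X Y : C} (κ : ShortExt E.conflation Q Y)
    (hQ : ExtVanish E.conflation (k + 1) X Q) (hB : ExtVanish E.conflation (k + 2) X κ.mid) :
    ExtVanish E.conflation (k + 2) X Y := by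
  rw [extVanish_succ_iff] at *
  intro ξ
  obtain ⟨η, hη⟩ := exists_equiv_spliceLeft κ ξ (hB _)
  exact ((pull_id_equiv ξ).symm.trans hη).null_iff.2 ((hQ η).spliceLeft κ)

/-! ### Projective dimension -/

lemma extVanish_succ_of_forall {k : ℕ} {X : C} (h : ∀ Y, ExtVanish E.conflation (k + 1) X Y)
    (Y : C) : ExtVanish E.conflation (k + 2) X Y := by
  rw [extVanish_succ_iff]
  intro ξ
  obtain ⟨Q, κ, η, rfl⟩ := exists_eq_spliceLeft ξ
  exact (extVanish_succ_iff.1 (h Q) η).spliceLeft κ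

lemma extVanish_of_le {k l : ℕ} {X : C} (h : ∀ Y, ExtVanish E.conflation (k + 1) X Y)
    (hkl : k ≤ l) (Y : C) : ExtVanish E.conflation (l + 1) X Y := by
  induction l, hkl using Nat.le_induction generalizing Y with
  | base => exact h Y
  | succ l _ ih => exact extVanish_succ_of_forall ih Y

lemma pdim_le_iff {d : ℕ} {X : C} :
    pdim E.conflation X ≤ d ↔ ∀ Y, ExtVanish E.conflation (d + 1) X Y := by
  refine ⟨fun h => ?_, fun h => iInf₂_le d h⟩
  have h' : pdim E.conflation X < ((d + 1 : ℕ) : ℕ∞) :=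
    lt_of_le_of_lt h (by exact_mod_cast Nat.lt_succ_self d)
  obtain ⟨n, h'⟩ := iInf_lt_iff.1 h'
  obtain ⟨hn, h'⟩ := iInf_lt_iff.1 h'
  exact extVanish_of_le hn (Nat.lt_succ_iff.1 (by exact_mod_cast h'))

lemma gldim_le_iff {d : ℕ} :
    gldim E.conflation ≤ d ↔ ∀ X Y, ExtVanish E.conflation (d + 1) X Y := by
  simp only [gldim, iSup_le_iff, pdim_le_iff]

lemma extVanish_of_isProj {P : C} (hP : IsProj E.conflation P) (k : ℕ) (Y : C) :
    ExtVanish E.conflation (k + 1) P Y := by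
  rw [extVanish_succ_iff]
  intro ξ
  obtain ⟨M, e, ⟨K, j, w, h⟩, n⟩ := exists_deflation_null ξ
  obtain ⟨s, hs⟩ := hP _ h (𝟙 P)
  change s ≫ e = 𝟙 P at hs
  rw [← hs]
  exact n.precomp s

lemma extVanish_of_iso {X X' : C} (e : X ≅ X') {k : ℕ} {Y : C}
    (h : ExtVanish E.conflation (k + 1) X Y) : ExtVanish E.conflation (k + 1) X' Y := by
  rw [extVanish_succ_iff] at *
  intro ξ
  simpa using (null_pull_iff.1 (h (pull k e.hom ξ))).precomp e.inv

/-- If `Ext^1(X, Y)` vanishes, every conflation with these end terms splits. -/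
lemma exists_retraction {X Y : C} (h : ExtVanish E.conflation 1 X Y)
    (α : ShortExt E.conflation X Y) : ∃ r : α.mid ⟶ Y, α.i ≫ r = 𝟙 Y := by
  obtain ⟨s, hs⟩ := extVanish_succ_iff.1 h α
  change s ≫ α.p = 𝟙 X at hs
  have := α.mono_i
  obtain ⟨r, hr⟩ := α.exists_lift (𝟙 _ - α.p ≫ s) (by simp [hs])
  refine ⟨r, ?_⟩
  rw [← cancel_mono α.i, Category.assoc, hr]
  simp [reassoc_of% α.w]

end LongExact

/-! ### Extension-closed subcategories of abelian categories -/

section Abelian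

variable {A : Type u} [Category.{v} A] [Abelian A] (P : ObjectProperty A)

lemma shortExact_cokernel {X Y : A} (i : X ⟶ Y) [Mono i] :
    (ShortComplex.mk i (cokernel.π i) (cokernel.condition i)).ShortExact :=
  .mk' (ShortComplex.exact_cokernel i) inferInstance inferInstance

lemma shortExact_kernel {X Y : A} (p : X ⟶ Y) [Epi p] :
    (ShortComplex.mk (kernel.ι p) p (kernel.condition p)).ShortExact :=
  .mk' (ShortComplex.exact_kernel p) inferInstance inferInstance

variable [P.IsClosedUnderIsomorphisms]

lemma isInflation_restrict_iff {X Y : P.FullSubcategory} (i : X ⟶ Y) :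
    IsInflation (restrict (fun S => S.ShortExact) P) i ↔ Mono i.hom ∧ P (cokernel i.hom) := by
  constructor
  · rintro ⟨Z, p, w, h⟩
    have h : ((ShortComplex.mk i p w).map P.ι).ShortExact := h
    exact ⟨h.mono_f, P.prop_of_iso
      (IsColimit.coconePointUniqueUpToIso h.gIsCokernel (colimit.isColimit _)) Z.property⟩
  · rintro ⟨h, hP⟩
    refine ⟨⟨_, hP⟩, ObjectProperty.homMk (cokernel.π i.hom), ?_, ?_⟩
    · ext; exact cokernel.condition _
    · exact shortExact_cokernel i.hom

lemma isDeflation_restrict_iff {X Y : P.FullSubcategory} (p : X ⟶ Y) :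
    IsDeflation (restrict (fun S => S.ShortExact) P) p ↔ Epi p.hom ∧ P (kernel p.hom) := by
  constructor
  · rintro ⟨Z, i, w, h⟩
    have h : ((ShortComplex.mk i p w).map P.ι).ShortExact := h
    exact ⟨h.epi_g, P.prop_of_iso
      (IsLimit.conePointUniqueUpToIso h.fIsKernel (limit.isLimit _)) Z.property⟩
  · rintro ⟨h, hP⟩
    refine ⟨⟨_, hP⟩, ObjectProperty.homMk (kernel.ι p.hom), ?_, ?_⟩
    · ext; exact kernel.condition _
    · exact shortExact_kernel p.hom

lemma shortExact_cokernel_comp {X Y Z : A} (i : X ⟶ Y) (j : Y ⟶ Z) [Mono j] :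
    ∃ (f : cokernel i ⟶ cokernel (i ≫ j)) (g : cokernel (i ≫ j) ⟶ cokernel j) (w : f ≫ g = 0),
      (ShortComplex.mk f g w).ShortExact := by
  have h := kernelCokernelCompSequence_exact i j
  refine ⟨_, _, _, .mk' (h.exact 3) ?_ ?_⟩
  · exact (h.exact 2).mono_g ((isZero_kernel_of_mono j).eq_of_src _ _)
  · exact inferInstanceAs (Epi ((kernelCokernelCompSequence i j).map' 4 5))

lemma shortExact_kernel_comp {X Y Z : A} (p : X ⟶ Y) (q : Y ⟶ Z) [Epi p] :
    ∃ (f : kernel p ⟶ kernel (p ≫ q)) (g : kernel (p ≫ q) ⟶ kernel q) (w : f ≫ g = 0),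
      (ShortComplex.mk f g w).ShortExact := by
  have h := kernelCokernelCompSequence_exact p q
  refine ⟨_, _, _, .mk' (h.exact 0) ?_ ?_⟩
  · exact inferInstanceAs (Mono ((kernelCokernelCompSequence p q).map' 0 1))
  · exact (h.exact 1).epi_f ((isZero_cokernel_of_epi p).eq_of_tgt _ _)

/-- An extension-closed full subcategory of an abelian category is an exact category. -/
def fullyExact [P.IsClosedUnderExtensions] [P.ContainsZero] : ExactStructure P.FullSubcategory where
  conflation := restrict (fun S => S.ShortExact) P
  of_iso e h := ShortComplex.shortExact_of_iso (P.ι.mapShortComplex.mapIso e) h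
  isKernel {S} h := by
    have h : (S.map P.ι).ShortExact := h
    have := h.mono_f
    have : Mono S.f := P.ι.mono_of_mono_map h.mono_f
    exact ⟨KernelFork.IsLimit.ofι' _ _ fun k hk =>
      ⟨ObjectProperty.homMk (h.exact.lift k.hom congr(($hk).hom)),
        by ext; exact h.exact.lift_f _ _⟩⟩
  isCokernel {S} h := by
    have h : (S.map P.ι).ShortExact := h
    have := h.epi_g
    have : Epi S.g := P.ι.epi_of_epi_map h.epi_g
    exact ⟨CokernelCofork.IsColimit.ofπ' _ _ fun k hk =>
      ⟨ObjectProperty.homMk (h.exact.desc k.hom congr(($hk).hom)),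
        by ext; exact h.exact.g_desc _ _⟩⟩
  id_inflation X := by
    rw [isInflation_restrict_iff]
    exact ⟨inferInstanceAs (Mono (𝟙 X.obj)), P.prop_of_isZero (isZero_cokernel_of_epi (𝟙 X.obj))⟩
  id_deflation X := by
    rw [isDeflation_restrict_iff]
    exact ⟨inferInstanceAs (Epi (𝟙 X.obj)), P.prop_of_isZero (isZero_kernel_of_mono (𝟙 X.obj))⟩
  comp_inflation i j hi hj := by
    rw [isInflation_restrict_iff] at *
    obtain ⟨hi, hi'⟩ := hi
    obtain ⟨hj, hj'⟩ := hj
    obtain ⟨f, g, w, h⟩ := shortExact_cokernel_comp i.hom j.hom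
    exact ⟨inferInstanceAs (Mono (i.hom ≫ j.hom)), P.prop_X₂_of_shortExact h hi' hj'⟩
  comp_deflation p q hp hq := by
    rw [isDeflation_restrict_iff] at *
    obtain ⟨hp, hp'⟩ := hp
    obtain ⟨hq, hq'⟩ := hq
    obtain ⟨f, g, w, h⟩ := shortExact_kernel_comp p.hom q.hom
    exact ⟨inferInstanceAs (Epi (p.hom ≫ q.hom)), P.prop_X₂_of_shortExact h hp' hq'⟩
  pushout_inflation {X Y X'} i f hi := by
    rw [isInflation_restrict_iff] at hi
    obtain ⟨hi, hi'⟩ := hi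
    have sq := IsPushout.of_hasPushout i.hom f.hom
    have hm : Mono (pushout.inr i.hom f.hom) := inferInstance
    have := isIso_cokernel_map_of_isPushout sq
    have hc : P (cokernel (pushout.inr i.hom f.hom)) :=
      P.prop_of_iso (asIso (cokernel.map _ _ _ _ sq.w)) hi'
    refine ⟨⟨_, P.prop_X₂_of_shortExact (shortExact_cokernel (pushout.inr i.hom f.hom))
      X'.property hc⟩, ObjectProperty.homMk (pushout.inl _ _),
      ObjectProperty.homMk (pushout.inr _ _), ?_, ?_⟩
    · exact IsPushout.of_map P.ι (by ext; exact sq.w) sq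
    · rw [isInflation_restrict_iff]
      exact ⟨hm, hc⟩
  pullback_deflation {X Y Y'} p f hp := by
    rw [isDeflation_restrict_iff] at hp
    obtain ⟨hp, hp'⟩ := hp
    have sq := IsPullback.of_hasPullback p.hom f.hom
    have hm : Epi (pullback.snd p.hom f.hom) := inferInstance
    have := isIso_kernel_map_of_isPullback sq.flip
    have hc : P (kernel (pullback.snd p.hom f.hom)) :=
      P.prop_of_iso (asIso (kernel.map _ _ _ _ sq.flip.w)).symm hp'
    refine ⟨⟨_, P.prop_X₂_of_shortExact (shortExact_kernel (pullback.snd p.hom f.hom))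
      hc Y'.property⟩, ObjectProperty.homMk (pullback.fst _ _),
      ObjectProperty.homMk (pullback.snd _ _), ?_, ?_⟩
    · exact IsPullback.of_map P.ι (by ext; exact sq.w) sq
    · rw [isDeflation_restrict_iff]
      exact ⟨hm, hc⟩

end Abelian

/-! ### Additive functors -/

section AdditiveFunctors

universe v' u'

variable {B : Type u} [Category.{v} B] [Preadditive B] {A : Type u'} [Category.{v'} A]

lemma additive_of_mono [Preadditive A] {F G : B ⥤ A} (η : F ⟶ G) [∀ X, Mono (η.app X)]
    [G.Additive] : F.Additive where
  map_add {X Y f g} := by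
    rw [← cancel_mono (η.app Y)]
    simp [Functor.map_add]

/-- Over a category with biproducts, an extension of additive functors is additive. -/
lemma additive_of_shortExact [HasBinaryBiproducts B] [Abelian A] {S : ShortComplex (B ⥤ A)}
    (hS : S.ShortExact) [S.X₁.Additive] [S.X₃.Additive] : S.X₂.Additive := by
  have hS' (U : B) : (S.map ((evaluation B A).obj U)).ShortExact := by
    have := hS.mono_f
    have := hS.epi_g
    have : Mono (((evaluation B A).obj U).map S.f) := inferInstanceAs (Mono (S.f.app U))
    have : Epi (((evaluation B A).obj U).map S.g) := inferInstanceAs (Epi (S.g.app U))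
    exact hS.map _
  have w (U : B) : S.f.app U ≫ S.g.app U = 0 := (S.map ((evaluation B A).obj U)).zero
  have fac {U V : B} (u : S.X₂.obj U ⟶ S.X₂.obj V) (hu : u ≫ S.g.app V = 0) :
      ∃ r, r ≫ S.f.app V = u := by
    have : Mono (S.map ((evaluation B A).obj V)).f := (hS' V).mono_f
    exact ⟨(hS' V).exact.lift u hu, (hS' V).exact.lift_f u hu⟩
  have map_zero (U V : B) : S.X₂.map (0 : U ⟶ V) = 0 := by
    obtain ⟨r, hr⟩ := fac (S.X₂.map (0 : U ⟶ V))
      (by rw [S.g.naturality, Functor.map_zero, comp_zero])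
    have h : S.f.app V ≫ S.X₂.map (0 : V ⟶ V) = 0 := by
      rw [← S.f.naturality, Functor.map_zero, zero_comp]
    calc S.X₂.map (0 : U ⟶ V) = S.X₂.map ((0 : U ⟶ V) ≫ (0 : V ⟶ V)) := by simp
      _ = 0 := by rw [S.X₂.map_comp, ← hr, Category.assoc, h, comp_zero]
  refine ⟨fun {Y U f g} => ?_⟩
  let p : Y ⊞ Y ⟶ Y ⊞ Y := biprod.fst ≫ biprod.inl
  let q : Y ⊞ Y ⟶ Y ⊞ Y := biprod.snd ≫ biprod.inr
  have hpq : p + q = 𝟙 _ := biprod.total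
  -- The deviation `e` from additivity on the two projections of `Y ⊞ Y` factors through the
  -- quotient and through the sub-object, so that `e ≫ e = 0`; on the other hand `e ≫ e = -e`.
  let e := S.X₂.map p + S.X₂.map q - 𝟙 _
  have he : e = 0 := by
    obtain ⟨r, hr⟩ := fac e (by
      have h := congrArg (fun x => S.g.app (Y ⊞ Y) ≫ S.X₃.map x) hpq
      simp only [Functor.map_add, Preadditive.comp_add] at h
      rw [S.X₃.map_id, Category.comp_id] at h
      simp only [e, Preadditive.add_comp, Preadditive.sub_comp, S.g.naturality, h,
        Category.id_comp, sub_self])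
    have h : S.f.app (Y ⊞ Y) ≫ e = 0 := by
      have h := congrArg (fun x => S.X₁.map x ≫ S.f.app (Y ⊞ Y)) hpq
      simp only [Functor.map_add, Preadditive.add_comp] at h
      rw [S.X₁.map_id, Category.id_comp] at h
      simp only [e, Preadditive.comp_add, Preadditive.comp_sub, ← S.f.naturality, h,
        Category.comp_id, sub_self]
    have h₁ : e ≫ e = 0 := by
      nth_rw 1 [← hr]
      rw [Category.assoc, h, comp_zero]
    have h₂ : e ≫ e = -e := by
      have hpp : p ≫ p = p := by simp [p]
      have hqq : q ≫ q = q := by simp [q]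
      have hpq' : p ≫ q = 0 := by simp [p, q]
      have hqp : q ≫ p = 0 := by simp [p, q]
      simp only [e, Preadditive.comp_add, Preadditive.add_comp, Preadditive.comp_sub,
        Preadditive.sub_comp, ← S.X₂.map_comp, hpp, hqq, hpq', hqp, map_zero, Category.comp_id,
        Category.id_comp]
      abel
    rw [← neg_eq_zero, ← h₂, h₁]
  have he' : S.X₂.map p + S.X₂.map q = 𝟙 _ := sub_eq_zero.1 he
  have hf : biprod.lift (𝟙 Y) (𝟙 Y) ≫ p ≫ biprod.desc f g = f := by simp [p]
  have hg : biprod.lift (𝟙 Y) (𝟙 Y) ≫ q ≫ biprod.desc f g = g := by simp [q]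
  calc S.X₂.map (f + g) = S.X₂.map (biprod.lift (𝟙 Y) (𝟙 Y)) ≫
        (S.X₂.map p + S.X₂.map q) ≫ S.X₂.map (biprod.desc f g) := by
        rw [he', Category.id_comp, ← S.X₂.map_comp, biprod.lift_desc, Category.id_comp,
          Category.id_comp]
    _ = S.X₂.map f + S.X₂.map g := by
        simp only [Preadditive.add_comp, Preadditive.comp_add, ← S.X₂.map_comp, hf, hg]

end AdditiveFunctors

/-! ### The category `mod_∞` -/

section ModInfty

variable {D : Type u} [Category.{v} D] [Preadditive D]

/-- Representable functors are projective with respect to additive functors. -/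
lemma exists_lift_of_epi {F G : Dᵒᵖ ⥤ AddCommGrpCat.{v}} [F.Additive] (g : F ⟶ G) [Epi g] {Y : D}
    (π : preadditiveYoneda.obj Y ⟶ G) : ∃ l : preadditiveYoneda.obj Y ⟶ F, l ≫ g = π := by
  have hg : Epi (g.app (Opposite.op Y)) := inferInstance
  obtain ⟨x, hx⟩ := (AddCommGrpCat.epi_iff_surjective _).1 hg (π.app (Opposite.op Y) (𝟙 Y))
  let l : preadditiveYoneda.obj Y ⟶ F :=
    { app := fun U => AddCommGrpCat.ofHom (AddMonoidHom.mk' (fun f : U.unop ⟶ Y => F.map f.op x)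
        (fun f f' => congrArg (fun t => AddCommGrpCat.Hom.hom t x)
          (F.map_add (f := f.op) (g := f'.op))))
      naturality := fun U V h => by
        ext (f : U.unop ⟶ Y)
        change F.map (h.unop ≫ f).op x = F.map h (F.map f.op x)
        simp }
  refine ⟨l, ?_⟩
  ext U (f : U.unop ⟶ Y)
  change g.app U (F.map f.op x) = π.app U f
  have h₁ := ConcreteCategory.congr_hom (g.naturality f.op) x
  have h₂ := ConcreteCategory.congr_hom (π.naturality f.op) (𝟙 Y)
  have h₃ : (preadditiveYoneda.obj Y).map f.op (𝟙 Y) = f := Category.comp_id f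
  calc g.app U (F.map f.op x) = G.map f.op (g.app (Opposite.op Y) x) := h₁
    _ = G.map f.op (π.app (Opposite.op Y) (𝟙 Y)) := congrArg _ hx
    _ = π.app U ((preadditiveYoneda.obj Y).map f.op (𝟙 Y)) := h₂.symm
    _ = π.app U f := congrArg _ h₃

/-- A first step of a resolution by representable functors: `F` is a quotient of a representable
functor by a member of `W`. -/
def PresentedBy (W : ObjectProperty (Dᵒᵖ ⥤ AddCommGrpCat.{v})) :
    ObjectProperty (Dᵒᵖ ⥤ AddCommGrpCat.{v}) :=
  fun F => ∃ (X : D) (K : Dᵒᵖ ⥤ AddCommGrpCat.{v}) (i : K ⟶ preadditiveYoneda.obj X)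
    (π : preadditiveYoneda.obj X ⟶ F) (w : i ≫ π = 0), (ShortComplex.mk i π w).ShortExact ∧ W K

/-- Coinduction: a class of additive functors each of which is a quotient of a representable functor
by a member of the class is contained in `mod_∞`. -/
lemma le_modInfty (W : ObjectProperty (Dᵒᵖ ⥤ AddCommGrpCat.{v})) (hadd : ∀ F, W F → F.Additive)
    (hW : W ≤ PresentedBy W) : W ≤ modInfty D := by
  intro F hF
  choose X K i π w h hK using hW
  let s : ℕ → {F // W F} := fun n => Nat.rec ⟨F, hF⟩ (fun _ G => ⟨K G.1 G.2, hK G.1 G.2⟩) n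
  let x (n : ℕ) : D := X (s n).1 (s n).2
  let p (n : ℕ) : preadditiveYoneda.obj (x n) ⟶ (s n).1 := π (s n).1 (s n).2
  let j (n : ℕ) : (s (n + 1)).1 ⟶ preadditiveYoneda.obj (x n) := i (s n).1 (s n).2
  have hw (n : ℕ) : j n ≫ p n = 0 := w (s n).1 (s n).2
  have hs (n : ℕ) : (ShortComplex.mk (j n) (p n) (hw n)).ShortExact := h (s n).1 (s n).2
  have hp (n : ℕ) : Epi (p n) := (hs n).epi_g
  have hj (n : ℕ) : Mono (j n) := (hs n).mono_f
  have ex (n : ℕ) : (ShortComplex.mk (p (n + 1) ≫ j n) (p n) (by simp [hw])).Exact := by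
    let φ : ShortComplex.mk (p (n + 1) ≫ j n) (p n) (by simp [hw]) ⟶
        ShortComplex.mk (j n) (p n) (hw n) := { τ₁ := p (n + 1), τ₂ := 𝟙 _, τ₃ := 𝟙 _ }
    have : Epi φ.τ₁ := hp (n + 1)
    have : IsIso φ.τ₂ := inferInstanceAs (IsIso (𝟙 _))
    have : Mono φ.τ₃ := inferInstanceAs (Mono (𝟙 _))
    exact (ShortComplex.exact_iff_of_epi_of_isIso_of_mono φ).2 (hs n).exact
  refine ⟨hadd F hF, x, fun n => p (n + 1) ≫ j n, p 0, hp 0, ⟨by simp [hw], ex 0⟩, fun n =>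
    ⟨by simp [reassoc_of% hw], ?_⟩⟩
  let φ : ShortComplex.mk (p (n + 2) ≫ j (n + 1)) (p (n + 1)) (by simp [hw]) ⟶
      ShortComplex.mk (p (n + 2) ≫ j (n + 1)) (p (n + 1) ≫ j n) (by simp [reassoc_of% hw]) :=
    { τ₁ := 𝟙 _, τ₂ := 𝟙 _, τ₃ := j n }
  have : Epi φ.τ₁ := inferInstanceAs (Epi (𝟙 _))
  have : IsIso φ.τ₂ := inferInstanceAs (IsIso (𝟙 _))
  have : Mono φ.τ₃ := hj n
  exact (ShortComplex.exact_iff_of_epi_of_isIso_of_mono φ).1 (ex (n + 1))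

lemma modInfty_le : modInfty D ≤ PresentedBy (modInfty D) := by
  rintro F ⟨hF, X, d, π, hπ, ⟨w, h⟩, hd⟩
  let t : preadditiveYoneda.obj (X 1) ⟶ kernel π := kernel.lift π (d 0) w
  have ht : t ≫ kernel.ι π = d 0 := kernel.lift_ι _ _ _
  have : Epi t := h.epi_kernelLift
  refine ⟨X 0, kernel π, kernel.ι π, π, kernel.condition π, shortExact_kernel π,
    additive_of_mono (kernel.ι π), fun n => X (n + 1), fun n => d (n + 1), t, this, ?_,
    fun n => hd (n + 1)⟩
  obtain ⟨w₀, h₀⟩ := hd 0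
  have w₁ : d 1 ≫ t = 0 := by rw [← cancel_mono (kernel.ι π), Category.assoc, ht, w₀, zero_comp]
  exact ⟨w₁, (ShortComplex.exact_iff_of_epi_of_isIso_of_mono
    (S₁ := ShortComplex.mk (d 1) t w₁) (S₂ := ShortComplex.mk (d 1) (d 0) w₀)
    { τ₁ := 𝟙 _, τ₂ := 𝟙 _, τ₃ := kernel.ι π, comm₂₃ := by simp [ht] }).2 h₀⟩

instance : (modInfty D).IsClosedUnderIsomorphisms where
  of_iso {F G} e := by
    rintro ⟨hF, X, d, π, hπ, ⟨w, h⟩, hd⟩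
    have w' : d 0 ≫ π ≫ e.hom = 0 := by rw [reassoc_of% w, zero_comp]
    exact ⟨additive_of_mono e.inv, X, d, π ≫ e.hom, epi_comp _ _, ⟨w',
      (ShortComplex.exact_iff_of_epi_of_isIso_of_mono (S₁ := ShortComplex.mk (d 0) π w)
        (S₂ := ShortComplex.mk (d 0) (π ≫ e.hom) w')
        { τ₁ := 𝟙 _, τ₂ := 𝟙 _, τ₃ := e.hom }).1 h⟩, hd⟩

instance [HasZeroObject D] : (modInfty D).ContainsZero where
  exists_zero := by
    obtain ⟨O, hO⟩ := HasZeroObject.zero (C := D)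
    have hO' : IsZero (preadditiveYoneda.obj O) := by
      rw [IsZero.iff_id_eq_zero]
      ext U (f : U.unop ⟶ O)
      exact hO.eq_of_tgt _ _
    refine ⟨_, hO', le_modInfty IsZero (fun F hF => ⟨fun {X Y f g} => ?_⟩) (fun F hF => ?_) _ hO'⟩
    · exact (hF.obj Y).eq_of_tgt _ _
    · exact ⟨O, _, 𝟙 _, 0, comp_zero, .mk'
        (ShortComplex.exact_of_isZero_X₂ _ hO') inferInstance
        ⟨fun _ _ _ => hF.eq_of_src _ _⟩, hO'⟩

/-- The kernels of an epimorphism between short exact sequences form a short exact sequence. -/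
lemma shortExact_kernel_of_epi {A : Type*} [Category* A] [Abelian A] {S₁ S₂ : ShortComplex A}
    (φ : S₁ ⟶ S₂) (h₁ : S₁.ShortExact) (h₂ : S₂.ShortExact) [Epi φ.τ₁] : (kernel φ).ShortExact := by
  let T : ShortComplex.SnakeInput A :=
    { L₀ := kernel φ, L₁ := S₁, L₂ := S₂, L₃ := cokernel φ
      v₀₁ := kernel.ι φ, v₁₂ := φ, v₂₃ := cokernel.π φ
      h₀ := kernelIsKernel φ, h₃ := cokernelIsCokernel φ
      L₁_exact := h₁.exact, epi_L₁_g := h₁.epi_g, L₂_exact := h₂.exact, mono_L₂_f := h₂.mono_f }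
  have hz : IsZero T.L₃.X₁ := by
    have : Epi T.v₁₂.τ₁ := inferInstanceAs (Epi φ.τ₁)
    exact (isZero_cokernel_of_epi T.v₁₂.τ₁).of_iso
      (IsColimit.coconePointUniqueUpToIso T.h₃τ₁ (colimit.isColimit _))
  have : Mono T.L₁.f := h₁.mono_f
  exact .mk' T.L₀_exact T.mono_L₀_f (T.L₁'_exact.epi_f (hz.eq_of_tgt _ _))

/-- The horseshoe lemma. -/
lemma exists_horseshoe {A : Type*} [Category* A] [Abelian A] {S : ShortComplex A}
    (hS : S.ShortExact) {P Q : A} (π : P ⟶ S.X₁) (ρ : Q ⟶ S.X₃) [Epi π] [Epi ρ] (l : Q ⟶ S.X₂)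
    (hl : l ≫ S.g = ρ) : Epi (biprod.desc (π ≫ S.f) l) ∧ ∃ R : ShortComplex A, R.ShortExact ∧
      Nonempty (R.X₁ ≅ kernel π) ∧ Nonempty (R.X₂ ≅ kernel (biprod.desc (π ≫ S.f) l)) ∧
      Nonempty (R.X₃ ≅ kernel ρ) := by
  let R : ShortComplex A := ShortComplex.mk (biprod.inl : P ⟶ P ⊞ Q) biprod.snd (by simp)
  have hR : R.ShortExact := (ShortComplex.Splitting.ofHasBinaryBiproduct P Q).shortExact
  let φ : R ⟶ S :=
    { τ₁ := π
      τ₂ := biprod.desc (π ≫ S.f) l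
      τ₃ := ρ
      comm₁₂ := by simp [R]
      comm₂₃ := by
        ext
        · simp [R]
        · simp [R, hl] }
  have h₁ : Epi φ.τ₁ := inferInstanceAs (Epi π)
  have h₃ : Epi φ.τ₃ := inferInstanceAs (Epi ρ)
  have := hR.epi_g
  have := hS.epi_g
  exact ⟨ShortComplex.epi_τ₂_of_exact_of_epi φ hS.exact, kernel φ,
    shortExact_kernel_of_epi φ hR hS, ⟨PreservesKernel.iso ShortComplex.π₁ φ⟩,
    ⟨PreservesKernel.iso ShortComplex.π₂ φ⟩, ⟨PreservesKernel.iso ShortComplex.π₃ φ⟩⟩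

instance : (preadditiveYoneda : D ⥤ Dᵒᵖ ⥤ AddCommGrpCat.{v}).Additive where
  map_add {X Y f g} := by
    ext U (h : U.unop ⟶ X)
    exact Preadditive.comp_add _ _ _ h f g

/-- Extension closure of `mod_∞` holds by applying the horseshoe lemma coinductively. -/
instance [HasBinaryBiproducts D] : (modInfty D).IsClosedUnderExtensions where
  prop_X₂_of_shortExact {S} hS hA hB := by
    let W : ObjectProperty (Dᵒᵖ ⥤ AddCommGrpCat.{v}) := fun F =>
      ∃ S : ShortComplex (Dᵒᵖ ⥤ AddCommGrpCat.{v}), S.ShortExact ∧ modInfty D S.X₁ ∧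
        modInfty D S.X₃ ∧ S.X₂ = F
    have hadd : ∀ F, W F → F.Additive := by
      rintro F ⟨S, hS, hA, hB, rfl⟩
      have := hA.1
      have := hB.1
      exact additive_of_shortExact hS
    refine le_modInfty W hadd ?_ _ ⟨S, hS, hA, hB, rfl⟩
    rintro F ⟨S, hS, hA, hB, rfl⟩
    have := hadd S.X₂ ⟨S, hS, hA, hB, rfl⟩
    have := hS.epi_g
    obtain ⟨X, K, i, π, w, hX, hK⟩ := modInfty_le _ hA
    obtain ⟨Y, L, j, ρ, w', hY, hL⟩ := modInfty_le _ hB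
    have : Epi π := hX.epi_g
    have : Epi ρ := hY.epi_g
    obtain ⟨l, hl⟩ := exists_lift_of_epi S.g ρ
    obtain ⟨he, R, hR, ⟨e₁⟩, ⟨e₂⟩, ⟨e₃⟩⟩ := exists_horseshoe hS π ρ l hl
    let τ := biprod.desc (π ≫ S.f) l
    have := preservesBinaryBiproducts_of_preservesBiproducts
      (preadditiveYoneda : D ⥤ Dᵒᵖ ⥤ AddCommGrpCat.{v})
    let e := preadditiveYoneda.mapBiprod X Y
    refine ⟨X ⊞ Y, R.X₂, e₂.hom ≫ kernel.ι τ ≫ e.inv, e.hom ≫ τ, by simp, ?_, R, hR,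
      (modInfty D).prop_of_iso ((IsLimit.conePointUniqueUpToIso hX.fIsKernel
        (limit.isLimit _)).trans e₁.symm) hK,
      (modInfty D).prop_of_iso ((IsLimit.conePointUniqueUpToIso hY.fIsKernel
        (limit.isLimit _)).trans e₃.symm) hL, rfl⟩
    exact ShortComplex.shortExact_of_iso
      (ShortComplex.isoMk (S₁ := ShortComplex.mk (kernel.ι τ) τ (kernel.condition τ))
        e₂.symm e.symm (Iso.refl S.X₂) (by simp) (by simp)) (shortExact_kernel τ)

end ModInfty

/-! ### Extensions and finite resolutions -/

section Resolutions

variable {C : Type u} [Category.{v} C] [Preadditive C] {E : ExactStructure C}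
  {P : ObjectProperty C}

/-- In the first variable, each step of a resolution raises the bound by one. -/
lemma extVanish_of_res {Y : C} {d : ℕ}
    (h : ∀ X, P X → ∀ k, d ≤ k → ExtVanish E.conflation (k + 1) X Y) :
    ∀ (m : ℕ) {M : C}, Res E.conflation P m M → ∀ k, d + m ≤ k →
      ExtVanish E.conflation (k + 1) M Y
  | 0, _, ⟨_, hX, ⟨e⟩⟩, k, hk => extVanish_of_iso e.symm (h _ hX k hk)
  | m + 1, M, ⟨K, X, i, p, w, hε, hX, hK⟩, k, hk => by
    obtain ⟨k, rfl⟩ : ∃ l, k = l + 1 := ⟨k - 1, by omega⟩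
    exact extVanish_right (⟨X, i, p, w, hε⟩ : ShortExt E.conflation M K)
      (extVanish_of_res h m hK k (by omega)) (h X hX (k + 1) (by omega))

/-- In the first variable, a coresolution does not raise the bound: the shift goes to higher
degrees, where the vanishing is known. -/
lemma extVanish_of_cores {Y : C} {d : ℕ}
    (h : ∀ X, P X → ∀ k, d ≤ k → ExtVanish E.conflation (k + 1) X Y) :
    ∀ (n : ℕ) {M : C}, Cores E.conflation P n M → ∀ k, d ≤ k →
      ExtVanish E.conflation (k + 1) M Y
  | 0, _, ⟨_, hX, ⟨e⟩⟩, k, hk => extVanish_of_iso e.symm (h _ hX k hk)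
  | n + 1, M, ⟨X, Q, i, p, w, hε, hX, hQ⟩, k, hk =>
    extVanish_left (⟨X, i, p, w, hε⟩ : ShortExt E.conflation Q M) (h X hX k hk)
      (extVanish_of_cores h n hQ (k + 1) (by omega))

/-- In the second variable, each step of a coresolution raises the bound by one. -/
lemma extVanish_of_cores_second [P.IsClosedUnderIsomorphisms] {M : C} {d : ℕ}
    (h : ∀ Y, P Y → ∀ k, d ≤ k → ExtVanish E.conflation (k + 1) M Y) :
    ∀ (n : ℕ) {Y : C}, Cores E.conflation P n Y → ∀ k, d + n ≤ k →
      ExtVanish E.conflation (k + 1) M Y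
  | 0, _, ⟨_, hX, ⟨e⟩⟩, k, hk => h _ (P.prop_of_iso e.symm hX) k hk
  | n + 1, Y, ⟨X, Q, i, p, w, hε, hX, hQ⟩, k, hk => by
    obtain ⟨k, rfl⟩ : ∃ l, k = l + 1 := ⟨k - 1, by omega⟩
    exact extVanish_second (⟨X, i, p, w, hε⟩ : ShortExt E.conflation Q Y)
      (extVanish_of_cores_second h n hQ k (by omega)) (h X hX (k + 1) (by omega))

universe v' u'

lemma Res.map {B : Type u} [Category.{v} B] [HasZeroMorphisms B] {B' : Type u'} [Category.{v'} B']
    [HasZeroMorphisms B'] {σ : ObjectProperty (ShortComplex B)} {P : ObjectProperty B}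
    {σ' : ObjectProperty (ShortComplex B')} {P' : ObjectProperty B'} (G : B ⥤ B')
    [G.PreservesZeroMorphisms] (hσ : ∀ S, σ S → σ' (S.map G)) (hP : ∀ X, P X → P' (G.obj X)) :
    ∀ (d : ℕ) {M : B}, Res σ P d M → Res σ' P' d (G.obj M)
  | 0, _, ⟨X, hX, ⟨e⟩⟩ => ⟨G.obj X, hP X hX, ⟨G.mapIso e⟩⟩
  | d + 1, _, ⟨K, X, i, p, _, hε, hX, hK⟩ =>
    ⟨G.obj K, G.obj X, G.map i, G.map p, _, hσ _ hε, hP X hX, Res.map G hσ hP d hK⟩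

/-- A projective resolution stops after `d` steps if the objects satisfying `V 0` are projective and
`V` shifts along syzygies. Here `V k M` stands for the vanishing of `Ext^{k+1}(M, -)` in some
larger category. -/
lemma res_isProj_of_shift {B : Type u} [Category.{v} B] [HasZeroMorphisms B]
    {σ : ObjectProperty (ShortComplex B)} (hσ : EnoughProj σ) (V : ℕ → B → Prop)
    (h₀ : ∀ S : ShortComplex B, σ S → IsProj σ S.X₂ → V 0 S.X₃ → IsProj σ S.X₃)
    (h : ∀ k, ∀ S : ShortComplex B, σ S → IsProj σ S.X₂ → V (k + 1) S.X₃ → V k S.X₁) :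
    ∀ (d : ℕ) {M : B}, V d M → Res σ (IsProj σ) d M
  | 0, M, hM => by
    obtain ⟨P, K, i, p, w, hP, hε⟩ := hσ M
    exact ⟨M, h₀ _ hε hP hM, ⟨Iso.refl M⟩⟩
  | d + 1, M, hM => by
    obtain ⟨P, K, i, p, w, hP, hε⟩ := hσ M
    exact ⟨K, P, i, p, w, hε, hP, res_isProj_of_shift hσ V h₀ h d (h d _ hε hP hM)⟩

end Resolutions

/-! ### The tilting functor -/

section Tilting

variable {C : Type u} [Category.{v} C] [Preadditive C] {E : ExactStructure C}
  {T : ObjectProperty C}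

lemma extVanish_of_perp {X Y : C} (hX : T X) (hY : perp E.conflation T Y) (k : ℕ) :
    ExtVanish E.conflation (k + 1) X Y :=
  hY (k + 1) (by omega) X hX

/-- The end term of a conflation with a retraction onto its sub-object is projective as soon as the
middle term is. -/
lemma isProj_of_retraction {S : ShortComplex (perp E.conflation T).FullSubcategory}
    (hS : restrict E.conflation (perp E.conflation T) S)
    (hP : IsProj (restrict E.conflation (perp E.conflation T)) S.X₂) (r : S.X₂ ⟶ S.X₁)
    (hr : S.f ≫ r = 𝟙 _) : IsProj (restrict E.conflation (perp E.conflation T)) S.X₃ := by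
  let ε : ShortExt E.conflation S.X₃.obj S.X₁.obj := ⟨_, _, _, _, hS⟩
  have hr' : S.f.hom ≫ r.hom = 𝟙 _ := congr(($hr).hom)
  have hg : Epi S.g.hom := ε.epi_p
  obtain ⟨s, hs⟩ := ε.exists_desc (𝟙 _ - r.hom ≫ S.f.hom) (by
    change S.f.hom ≫ (𝟙 S.X₂.obj - r.hom ≫ S.f.hom) = 0
    rw [Preadditive.comp_sub, reassoc_of% hr', Category.comp_id, sub_self])
  change S.g.hom ≫ s = 𝟙 S.X₂.obj - r.hom ≫ S.f.hom at hs
  have hs' : s ≫ S.g.hom = 𝟙 S.X₃.obj := by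
    have hw : S.f.hom ≫ S.g.hom = 0 := ε.w
    rw [← cancel_epi S.g.hom, reassoc_of% hs, Preadditive.sub_comp, Category.assoc, hw]
    simp
  intro R hR f
  obtain ⟨g, hg⟩ := hP R hR (S.g ≫ f)
  refine ⟨ObjectProperty.homMk s ≫ g, ?_⟩
  rw [Category.assoc, hg, ← Category.assoc]
  exact (congrArg (· ≫ f) (by ext; exact hs')).trans (Category.id_comp f)

namespace IsTilting

variable (hT : IsTilting E.conflation T)
include hT

lemma perp_of_isZero {O : C} (hO : IsZero O) : perp E.conflation T O := by
  obtain ⟨X, i, hX, -⟩ := hT.finitelyCoresolving.coresolving.copres_all O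
  exact hT.finitelyCoresolving.coresolving.inflationClosed _ (conflation_id_left X hO) hX hX

lemma isClosedUnderIsomorphisms_perp : (perp E.conflation T).IsClosedUnderIsomorphisms where
  of_iso {X Y} e hX := by
    obtain ⟨O, hO⟩ := exists_isZero E X
    exact hT.finitelyCoresolving.coresolving.extensionClosed _ (conflation_iso_left e hO) hX
      (hT.perp_of_isZero hO)

lemma le_perp : T ≤ perp E.conflation T := hT.selfOrthogonal

lemma prop_of_isZero {O : C} (hO : IsZero O) : T O :=
  (hT.proj_iff ⟨O, hT.perp_of_isZero hO⟩).1 fun S hS f =>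
    ⟨0, by ext; exact hO.eq_of_src _ _⟩

/-- Split extensions of objects of `T` belong to `T`, as sums of projective objects of `T^⊥`. -/
lemma prop_mid {X Y : C} (hX : T X) (hY : T Y) (α : ShortExt E.conflation X Y) (r : α.mid ⟶ Y)
    (s : X ⟶ α.mid) (h : r ≫ α.i + α.p ≫ s = 𝟙 α.mid) : T α.mid := by
  have hm : perp E.conflation T α.mid := hT.finitelyCoresolving.coresolving.extensionClosed _ α.mem
    (hT.selfOrthogonal Y hY) (hT.selfOrthogonal X hX)
  refine (hT.proj_iff ⟨α.mid, hm⟩).1 fun S hS f => ?_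
  obtain ⟨a, ha⟩ := (hT.proj_iff ⟨X, hT.selfOrthogonal X hX⟩).2 hX S hS
    (ObjectProperty.homMk (s ≫ f.hom))
  obtain ⟨b, hb⟩ := (hT.proj_iff ⟨Y, hT.selfOrthogonal Y hY⟩).2 hY S hS
    (ObjectProperty.homMk (α.i ≫ f.hom))
  have ha' : a.hom ≫ S.g.hom = s ≫ f.hom := congr(($ha).hom)
  have hb' : b.hom ≫ S.g.hom = α.i ≫ f.hom := congr(($hb).hom)
  refine ⟨ObjectProperty.homMk (r ≫ b.hom + α.p ≫ a.hom), ?_⟩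
  ext
  change (r ≫ b.hom + α.p ≫ a.hom) ≫ S.g.hom = f.hom
  rw [Preadditive.add_comp, Category.assoc, Category.assoc, ha', hb', ← Category.assoc,
    ← Category.assoc, ← Preadditive.add_comp, h, Category.id_comp]

lemma hasZeroObject (X : C) : HasZeroObject T.FullSubcategory := by
  obtain ⟨O, hO⟩ := exists_isZero E X
  exact ⟨⟨O, hT.prop_of_isZero hO⟩, ⟨fun Y => ⟨⟨⟨0⟩, fun f => by ext; exact hO.eq_of_src _ _⟩⟩,
    fun Y => ⟨⟨⟨0⟩, fun f => by ext; exact hO.eq_of_tgt _ _⟩⟩⟩⟩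

lemma hasBinaryBiproducts : HasBinaryBiproducts T.FullSubcategory where
  has_binary_biproduct Y X := by
    obtain ⟨α, r, s, hr, hs, hsr, h⟩ := exists_split E X.obj Y.obj
    let b : BinaryBicone Y X :=
      { pt := ⟨α.mid, hT.prop_mid X.property Y.property α r s h⟩
        fst := ObjectProperty.homMk r
        snd := ObjectProperty.homMk α.p
        inl := ObjectProperty.homMk α.i
        inr := ObjectProperty.homMk s
        inl_fst := by ext; exact hr
        inl_snd := by ext; exact α.w
        inr_fst := by ext; exact hsr
        inr_snd := by ext; exact hs }
    exact hasBinaryBiproduct_of_total b (by ext; exact h)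

/-- Every object of `T^⊥` is the end term of a conflation in `T^⊥` with middle term in `T`. -/
lemma exists_shortComplex (M : (perp E.conflation T).FullSubcategory) :
    ∃ S : ShortComplex (perp E.conflation T).FullSubcategory,
      restrict E.conflation (perp E.conflation T) S ∧ T S.X₂.obj ∧ S.X₃ = M := by
  obtain ⟨P, K, i, p, w, hP, h⟩ := hT.enoughProj M
  exact ⟨_, h, (hT.proj_iff _).1 hP, rfl⟩

end IsTilting

/-- A complex of functors is exact if it is so objectwise. -/
lemma exact_of_evaluation {B : Type*} [Category* B] {A : Type*} [Category* A] [Abelian A]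
    (S : ShortComplex (B ⥤ A)) (h : ∀ U, (S.map ((evaluation B A).obj U)).Exact) : S.Exact := by
  rw [ShortComplex.exact_iff_isZero_homology, Functor.isZero_iff]
  intro U
  exact ((ShortComplex.exact_iff_isZero_homology _).1 (h U)).of_iso
    (S.mapHomologyIso ((evaluation B A).obj U)).symm

instance : (tiltingFunctor E.conflation T).Additive where
  map_add {X Y f g} := by
    ext U (h : U.unop.obj ⟶ X.obj)
    exact Preadditive.comp_add _ _ _ h f.hom g.hom

/-- The tilting functor is exact. -/
lemma IsTilting.shortExact_map (hT : IsTilting E.conflation T)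
    {S : ShortComplex (perp E.conflation T).FullSubcategory}
    (hS : restrict E.conflation (perp E.conflation T) S) :
    (S.map (tiltingFunctor E.conflation T)).ShortExact := by
  let ε : ShortExt E.conflation S.X₃.obj S.X₁.obj := ⟨_, _, _, _, hS⟩
  have hm : Mono S.f.hom := ε.mono_i
  refine .mk' (exact_of_evaluation _ fun U => ?_) ?_ ?_
  · rw [ShortComplex.ab_exact_iff]
    intro (x : U.unop.obj ⟶ S.X₂.obj) (hx : x ≫ S.g.hom = 0)
    exact ε.exists_lift x hx
  · rw [NatTrans.mono_iff_mono_app]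
    intro U
    rw [AddCommGrpCat.mono_iff_injective]
    intro (x : U.unop.obj ⟶ S.X₁.obj) (y : U.unop.obj ⟶ S.X₁.obj) (h : x ≫ S.f.hom = y ≫ S.f.hom)
    exact (cancel_mono S.f.hom).1 h
  · rw [NatTrans.epi_iff_epi_app]
    intro U
    rw [AddCommGrpCat.epi_iff_surjective]
    intro (x : U.unop.obj ⟶ S.X₃.obj)
    obtain ⟨y, hy⟩ := (hT.proj_iff ⟨_, hT.le_perp _ U.unop.property⟩).2 U.unop.property S hS
      (ObjectProperty.homMk x)
    exact ⟨y.hom, congr(($hy).hom)⟩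

/-- On objects of `T`, the tilting functor is the Yoneda embedding. -/
def yonedaIso {M : (perp E.conflation T).FullSubcategory} (hM : T M.obj) :
    preadditiveYoneda.obj (⟨M.obj, hM⟩ : T.FullSubcategory) ≅
      (tiltingFunctor E.conflation T).obj M :=
  NatIso.ofComponents (fun U => AddEquiv.toAddCommGrpIso
    { toFun := fun (f : U.unop ⟶ ⟨M.obj, hM⟩) => (f.hom : U.unop.obj ⟶ M.obj)
      invFun := fun (f : U.unop.obj ⟶ M.obj) => ObjectProperty.homMk f
      left_inv := fun _ => rfl
      right_inv := fun _ => rfl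
      map_add' := fun _ _ => rfl }) (fun _ => rfl)

lemma IsTilting.modInfty_obj (hT : IsTilting E.conflation T)
    (M : (perp E.conflation T).FullSubcategory) :
    modInfty T.FullSubcategory ((tiltingFunctor E.conflation T).obj M) := by
  refine le_modInfty (fun F => ∃ M, (tiltingFunctor E.conflation T).obj M = F) ?_ ?_ _ ⟨M, rfl⟩
  · rintro _ ⟨M, rfl⟩
    refine ⟨fun {U V f g} => ?_⟩
    ext (h : U.unop.obj ⟶ M.obj)
    exact Preadditive.add_comp _ _ _ f.unop.hom g.unop.hom h
  · rintro _ ⟨M, rfl⟩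
    obtain ⟨S, hS, hP, rfl⟩ := hT.exists_shortComplex M
    let e := yonedaIso (E := E) hP
    have h := hT.shortExact_map hS
    refine ⟨⟨_, hP⟩, _, (tiltingFunctor E.conflation T).map S.f ≫ e.inv,
      e.hom ≫ (tiltingFunctor E.conflation T).map S.g, ?_, ?_, S.X₁, rfl⟩
    · simp [← Functor.map_comp, S.zero]
    · exact ShortComplex.shortExact_of_iso
        (ShortComplex.isoMk (S₁ := S.map (tiltingFunctor E.conflation T))
          (Iso.refl _) e.symm (Iso.refl _) (Category.id_comp _)
          ((e.inv_hom_id_assoc _).trans (Category.comp_id _).symm)) h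

/-- The tilting functor as a functor to `mod_∞-T`. -/
def IsTilting.toMod (hT : IsTilting E.conflation T) :
    (perp E.conflation T).FullSubcategory ⥤ (modInfty T.FullSubcategory).FullSubcategory :=
  (modInfty T.FullSubcategory).lift (tiltingFunctor E.conflation T) hT.modInfty_obj

instance (hT : IsTilting E.conflation T) : hT.toMod.PreservesZeroMorphisms where
  map_zero X Y := by
    ext : 1
    exact (tiltingFunctor E.conflation T).map_zero X Y

lemma IsTilting.isProj_toMod (hT : IsTilting E.conflation T)
    {M : (perp E.conflation T).FullSubcategory} (hM : T M.obj) :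
    IsProj (modConflation T.FullSubcategory) (hT.toMod.obj M) := by
  intro S hS f
  have hS : (S.map (modInfty T.FullSubcategory).ι).ShortExact := hS
  have : Epi S.g.hom := hS.epi_g
  have := S.X₂.property.1
  let e := yonedaIso (E := E) hM
  obtain ⟨l, hl⟩ := exists_lift_of_epi S.g.hom (e.hom ≫ f.hom)
  refine ⟨ObjectProperty.homMk (e.inv ≫ l), ?_⟩
  ext : 1
  change (e.inv ≫ l) ≫ S.g.hom = f.hom
  rw [Category.assoc, hl]
  exact e.inv_hom_id_assoc _

/-- The tilting functor reflects retractions whose source lies in `T`. -/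
lemma IsTilting.exists_retraction_of_map (hT : IsTilting E.conflation T)
    {K P : (perp E.conflation T).FullSubcategory} (hP : T P.obj) (i : K ⟶ P)
    (r : (tiltingFunctor E.conflation T).obj P ⟶ (tiltingFunctor E.conflation T).obj K)
    (hr : (tiltingFunctor E.conflation T).map i ≫ r = 𝟙 _) : ∃ ρ : P ⟶ K, i ≫ ρ = 𝟙 K := by
  let ρ : P.obj ⟶ K.obj := r.app (Opposite.op ⟨P.obj, hP⟩) (𝟙 P.obj)
  refine ⟨ObjectProperty.homMk ρ, ?_⟩
  obtain ⟨S, hS, hQ, rfl⟩ := hT.exists_shortComplex K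
  have : Epi S.g.hom := ShortExt.epi_p (E := E) ⟨_, _, _, _, hS⟩
  ext
  change i.hom ≫ ρ = 𝟙 S.X₃.obj
  rw [← cancel_epi S.g.hom]
  let q : (⟨S.X₂.obj, hQ⟩ : T.FullSubcategory) ⟶ ⟨P.obj, hP⟩ :=
    ObjectProperty.homMk (S.g.hom ≫ i.hom)
  have h₁ := ConcreteCategory.congr_hom (r.naturality q.op) (𝟙 P.obj)
  have h₂ := ConcreteCategory.congr_hom (NatTrans.congr_app hr (Opposite.op ⟨S.X₂.obj, hQ⟩))
    (S.g.hom : S.X₂.obj ⟶ S.X₃.obj)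
  have h₃ : r.app (Opposite.op ⟨S.X₂.obj, hQ⟩) (S.g.hom ≫ i.hom) = S.g.hom := h₂
  have h₄ : r.app (Opposite.op ⟨S.X₂.obj, hQ⟩) ((S.g.hom ≫ i.hom) ≫ 𝟙 P.obj) =
    (S.g.hom ≫ i.hom) ≫ ρ := h₁
  rw [Category.comp_id, h₃, Category.assoc] at h₄
  rw [Category.comp_id]
  exact h₄.symm

end Tilting

/-! ### Comparison of global dimensions -/

section Comparison

variable {C : Type u} [Category.{v} C] [Preadditive C] {E : ExactStructure C}
  {T : ObjectProperty C}

namespace IsTilting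

variable (hT : IsTilting E.conflation T)
include hT

/-- If the base category has global dimension at most `d`, every object of `T^⊥` has a resolution of
length `d` by objects of `T`: the extension groups in the base category shift along syzygies since
objects of `T` have no higher extensions with values in `T^⊥`. -/
lemma res_of_gldim_le {d : ℕ} (h : gldim E.conflation ≤ d)
    (M : (perp E.conflation T).FullSubcategory) :
    Res (restrict E.conflation (perp E.conflation T))
      (IsProj (restrict E.conflation (perp E.conflation T))) d M := by
  refine res_isProj_of_shift hT.enoughProj (fun k M => ∀ Y, perp E.conflation T Y →
    ExtVanish E.conflation (k + 1) M.obj Y) ?_ ?_ d fun Y _ => gldim_le_iff.1 h _ Y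
  · intro S hS hP hV
    obtain ⟨r, hr⟩ := exists_retraction (hV _ S.X₁.property) ⟨_, _, _, _, hS⟩
    exact isProj_of_retraction hS hP (ObjectProperty.homMk r) (by ext; exact hr)
  · intro k S hS hP hV Y hY
    exact extVanish_left ⟨_, _, _, _, hS⟩ (extVanish_of_perp ((hT.proj_iff _).1 hP) hY k)
      (hV Y hY)

/-- If `mod_∞-T` has global dimension at most `d`, every object of `T^⊥` has a resolution of length
`d` by objects of `T`: a splitting of the image of a syzygy sequence lifts to `T^⊥`. -/
lemma res_of_gldim_mod_le {d : ℕ} [HasZeroObject T.FullSubcategory]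
    [HasBinaryBiproducts T.FullSubcategory] (h : gldim (modConflation T.FullSubcategory) ≤ d)
    (M : (perp E.conflation T).FullSubcategory) :
    Res (restrict E.conflation (perp E.conflation T))
      (IsProj (restrict E.conflation (perp E.conflation T))) d M := by
  let E' := fullyExact (modInfty T.FullSubcategory)
  refine res_isProj_of_shift hT.enoughProj (fun k M => ∀ G,
    ExtVanish E'.conflation (k + 1) (hT.toMod.obj M) G) ?_ ?_ d
    fun G => gldim_le_iff (E := E').1 h _ G
  · intro S hS hP hV
    have hS' : E'.conflation (S.map hT.toMod) := hT.shortExact_map hS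
    obtain ⟨r, hr⟩ := exists_retraction (hV (hT.toMod.obj S.X₁)) ⟨_, _, _, _, hS'⟩
    obtain ⟨ρ, hρ⟩ := hT.exists_retraction_of_map ((hT.proj_iff _).1 hP) S.f r.hom congr(($hr).hom)
    exact isProj_of_retraction hS hP ρ hρ
  · intro k S hS hP hV G
    have hS' : E'.conflation (S.map hT.toMod) := hT.shortExact_map hS
    exact extVanish_left ⟨_, _, _, _, hS'⟩
      (extVanish_of_isProj (hT.isProj_toMod ((hT.proj_iff _).1 hP)) k G) (hV G)

/-- If every object of `T^⊥` has a resolution of length `d` by objects of `T`, the base category has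
global dimension at most `d + n`. -/
lemma gldim_le_of_res {d n : ℕ} (hn : ∀ M, Cores E.conflation (perp E.conflation T) n M)
    (h : ∀ M, Res (restrict E.conflation (perp E.conflation T))
      (IsProj (restrict E.conflation (perp E.conflation T))) d M) :
    gldim E.conflation ≤ (d + n : ℕ) := by
  have := hT.isClosedUnderIsomorphisms_perp
  have h₁ (X : C) (hX : perp E.conflation T X) (Y : C) (hY : perp E.conflation T Y) (k : ℕ)
      (hk : d ≤ k) : ExtVanish E.conflation (k + 1) X Y :=
    extVanish_of_res (P := T) (d := 0) (fun X hX k _ => extVanish_of_perp hX hY k) d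
      (Res.map (perp E.conflation T).ι (fun S hS => hS) (fun X hX => (hT.proj_iff X).1 hX) d
        (h ⟨X, hX⟩)) k (by omega)
  have h₂ (M Y : C) (hY : perp E.conflation T Y) (k : ℕ) (hk : d ≤ k) :
      ExtVanish E.conflation (k + 1) M Y :=
    extVanish_of_cores (fun X hX k hk => h₁ X hX Y hY k hk) n (hn M) k hk
  exact gldim_le_iff.2 fun M Y =>
    extVanish_of_cores_second (fun Y hY k hk => h₂ M Y hY k hk) n (hn Y) (d + n) le_rfl

/-- If every object of `T^⊥` has a resolution of length `d` by objects of `T`, and every object of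
`mod_∞-T` has a resolution of length `m` by images of objects of `T^⊥`, the global dimension of
`mod_∞-T` is at most `d + m`. -/
lemma gldim_mod_le_of_res {d m : ℕ} [HasZeroObject T.FullSubcategory]
    [HasBinaryBiproducts T.FullSubcategory]
    (hm : ∀ F, Res (modConflation T.FullSubcategory) (tiltingImage E.conflation T) m F)
    (h : ∀ M, Res (restrict E.conflation (perp E.conflation T))
      (IsProj (restrict E.conflation (perp E.conflation T))) d M) :
    gldim (modConflation T.FullSubcategory) ≤ (d + m : ℕ) := by
  let E' := fullyExact (modInfty T.FullSubcategory)
  refine gldim_le_iff (E := E').2 fun F G =>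
    extVanish_of_res (E := E') (d := d) ?_ m (hm F) (d + m) le_rfl
  rintro F ⟨M, ⟨e⟩⟩ k hk
  refine extVanish_of_iso (X := hT.toMod.obj M) (ObjectProperty.isoMk _ e) ?_
  exact extVanish_of_res (E := E') (P := IsProj E'.conflation) (d := 0)
    (fun X hX k _ => extVanish_of_isProj hX k G) d
    (Res.map hT.toMod (fun S hS => hT.shortExact_map hS)
      (fun X hX => hT.isProj_toMod ((hT.proj_iff X).1 hX)) d (h M)) k (by omega)

end IsTilting

end Comparison

end ExactCat

theorem mainTheorem8 {C : Type u} [Category.{v} C] [Preadditive C] [HasFiniteBiproducts C]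
    [IsIdempotentComplete C] (E : ExactCat.ExactStructure C) (T : ObjectProperty C) (m n : ℕ)
    (hT : ExactCat.IsIdeqTilting E.conflation T m n) :
    ExactCat.gldim E.conflation ≤
        ExactCat.gldim (ExactCat.modConflation T.FullSubcategory) + (n : ℕ∞) ∧
      ExactCat.gldim (ExactCat.modConflation T.FullSubcategory) ≤
        ExactCat.gldim E.conflation + (m : ℕ∞) := by
  have ht := hT.nTilting.tilting
  obtain ⟨O, -⟩ := (hasZeroObject_of_hasFiniteBiproducts C).zero
  have := ht.hasZeroObject O
  have := ht.hasBinaryBiproducts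
  constructor
  · cases h : ExactCat.gldim (ExactCat.modConflation T.FullSubcategory) with
    | top => simp
    | coe d =>
      exact_mod_cast ht.gldim_le_of_res hT.nTilting.cores_all (ht.res_of_gldim_mod_le h.le)
  · cases h : ExactCat.gldim E.conflation with
    | top => simp
    | coe d =>
      exact_mod_cast ht.gldim_mod_le_of_res hT.image_resolving.res_all (ht.res_of_gldim_le h.le)
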